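/- **Theorem.** Let $P\subset\mathbb{R}^d$ be a $d$-dimensional simple convex polytope (every vertex is incident with exactly $d$ edges of $P$), with vertex set $\mathrm{Vert}(P)$ of cardinality $N$. For a vertex $v$ let $w_1(v),\dots,w_d(v)$ be edge vectors pointing from $v$ along the $d$ edges of $P$ at $v$, and put $$D_v(z)=\frac{|\det(w_1(v),\dots,w_d(v))|}{\prod_{k=1}^d\langle w_k(v),z\rangle}.$$ Let $z\in\mathbb{R}^d$ be in general position, i.e. $z$ is neither a zero nor a pole of $D_v$ for any $v\in\mathrm{Vert}(P)$, and $\langle v_1,z\rangle\neq\langle v_2,z\rangle$ for any two distinct vertices $v_1,v_2$ of $P$. Let $$\mu_j(z)=\int_P\langle x,z\rangle^j\,dx\qquad(j\ge 0)$$ be the moments of $P$ (Lebesgue measure), and define the scaled moments by $c_i=0$ for $1\le i\le d$ and $$c_{k+1}=\frac{k!\,(-1)^d}{(k-d)!}\,\mu_{k-d}(z)\qquad(k\ge d).$$ Let $m\ge N+1$, let $H=(c_{i+j-1})_{1\le i,j\le m}$ be the $m\times m$ Hankel matrix of $c_1,\dots,c_{2m-1}$, and write $$p_z(t)=\prod_{v\in\mathrm{Vert}(P)}(t-\langle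 v,z\rangle)=t^N+\sum_{i=0}^{N-1}a_it^i.$$ Then $H$ has rank $N$, and its kernel is spanned by the $m-N$ linearly independent vectors $$\mathbf{a}_\ell=(\underbrace{0,\dots,0}_{\ell},a_0,\dots,a_{N-1},1,\underbrace{0,\dots,0}_{m-N-1-\ell}),\qquad 0\le\ell\le m-N-1.$$ -/

import Mathlib

open scoped RealInnerProductSpace

noncomputable section

namespace InverseMoment

/-- The vertices of `P`: its extreme points. -/
def vert {d : ℕ} (P : Set (EuclideanSpace ℝ (Fin d))) : Set (EuclideanSpace ℝ (Fin d)) :=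
  P.extremePoints ℝ

/-- The vertices adjacent to `v`: those `u ≠ v` for which the segment `[v, u]` is a face of `P`
(a convex extreme subset). Since an edge at `v` is determined by its other endpoint, these
points are in bijection with the edges of `P` incident with the vertex `v`. -/
def neighbors {d : ℕ} (P : Set (EuclideanSpace ℝ (Fin d))) (v : EuclideanSpace ℝ (Fin d)) :
    Set (EuclideanSpace ℝ (Fin d)) :=
  {u | u ∈ vert P ∧ u ≠ v ∧ IsExtreme ℝ P (segment ℝ v u)}

/-- A simple `d`-dimensional convex polytope in `ℝ^d`: the convex hull of finitely many points,
full-dimensional, with every vertex incident with exactly `d` edges. -/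
structure IsSimplePolytope {d : ℕ} (P : Set (EuclideanSpace ℝ (Fin d))) : Prop where
  exists_finset : ∃ s : Finset (EuclideanSpace ℝ (Fin d)),
    P = convexHull ℝ (s : Set (EuclideanSpace ℝ (Fin d)))
  nonempty_interior : (interior P).Nonempty
  simple : ∀ v ∈ vert P, (neighbors P v).ncard = d

/-- `w_1, …, w_d` is an enumeration, without repetition, of the edge vectors of `P` at `v`,
pointing from `v` to the other endpoint of the edge. -/
def IsEdgeFrame {d : ℕ} (P : Set (EuclideanSpace ℝ (Fin d))) (v : EuclideanSpace ℝ (Fin d))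
    (w : Fin d → EuclideanSpace ℝ (Fin d)) : Prop :=
  Function.Injective w ∧ Set.range w = (fun u => u - v) '' neighbors P v

/-- The denominator `∏ k, ⟨w_k, z⟩` of the rational function `D_v(z)`. -/
def edgeProd {d : ℕ} (w : Fin d → EuclideanSpace ℝ (Fin d)) (z : EuclideanSpace ℝ (Fin d)) : ℝ :=
  ∏ k, ⟪w k, z⟫

/-- `D_v(z) = |det (w_1, …, w_d)| / ∏ k, ⟨w_k, z⟩`. The value does not depend on the order or the
(positive) lengths of the edge vectors `w_k` at `v`. -/
def vertexCoeff {d : ℕ} (w : Fin d → EuclideanSpace ℝ (Fin d))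
    (z : EuclideanSpace ℝ (Fin d)) : ℝ :=
  |(Matrix.of fun i k => w k i).det| / edgeProd w z

/-- `z` is in general position with respect to the simple polytope `P`: it is neither a pole nor a
zero of `D_v` for any vertex `v`, and distinct vertices have distinct projections onto `z`. -/
structure GeneralPosition {d : ℕ} (P : Set (EuclideanSpace ℝ (Fin d)))
    (z : EuclideanSpace ℝ (Fin d)) : Prop where
  not_pole : ∀ v ∈ vert P, ∀ w, IsEdgeFrame P v w → edgeProd w z ≠ 0
  not_zero : ∀ v ∈ vert P, ∀ w, IsEdgeFrame P v w → vertexCoeff w z ≠ 0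
  injOn : Set.InjOn (fun v => ⟪v, z⟫) (vert P)

/-- The moment `μ_j(z) = ∫_P ⟨x, z⟩ ^ j dx` for the uniform density. -/
def moment {d : ℕ} (P : Set (EuclideanSpace ℝ (Fin d))) (z : EuclideanSpace ℝ (Fin d))
    (j : ℕ) : ℝ :=
  ∫ x in P, ⟪x, z⟫ ^ j

/-- The scaled moment `c_i`, for `i ≥ 1`: it is `0` for `1 ≤ i ≤ d`, and
`c_{k+1} = (-1)^d * k! / (k-d)! * μ_{k-d}(z)` for `k ≥ d`. The value at `i = 0` is never used. -/
def scaledMoment {d : ℕ} (P : Set (EuclideanSpace ℝ (Fin d))) (z : EuclideanSpace ℝ (Fin d))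
    (i : ℕ) : ℝ :=
  if i ≤ d then 0
  else (((i - 1).factorial : ℝ) * (-1) ^ d / ((i - 1 - d).factorial : ℝ)) * moment P z (i - 1 - d)

/-- The `m × m` Hankel matrix `H(c_1, …, c_{2m-1})`; with indices `i, j` counted from `0`, its
entries are `c_{i+j+1}`. -/
def hankel (c : ℕ → ℝ) (m : ℕ) : Matrix (Fin m) (Fin m) ℝ :=
  Matrix.of fun i j => c ((i : ℕ) + (j : ℕ) + 1)

/-- `p_z(t) = ∏_{v ∈ Vert P} (t - ⟨v, z⟩)`. -/
def projPoly {d : ℕ} (P : Set (EuclideanSpace ℝ (Fin d))) (z : EuclideanSpace ℝ (Fin d)) :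
    Polynomial ℝ :=
  ∏ᶠ v ∈ vert P, (Polynomial.X - Polynomial.C ⟪v, z⟫)

/-- The vector `(0, …, 0, p_0, p_1, p_2, …)` of length `m`: `l` zeros followed by the coefficients
of `p`, starting with the constant one (zeros after the leading coefficient). -/
def shiftedCoeffs (p : Polynomial ℝ) (m l : ℕ) : Fin m → ℝ :=
  fun i => if (i : ℕ) < l then 0 else p.coeff ((i : ℕ) - l)

end InverseMoment

end

/-!
Triangulate the polytope `P`, using no vertices other than its own. For a single simplex with
vertices `v_0, …, v_d`, the Hermite–Genocchi formula (`hermite_genocchi`,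
`integral_simplex_dividedPow`) expresses the moments in the direction `z` as combinations of the
powers `⟪v_i, z⟫ ^ k`, where the coefficient of `v_i` is, up to sign, the determinant of the edge
vectors at `v_i` divided by the product of their inner products with `z`. Summing over the
triangulation gives `c_{k+1} = ∑ v, B_v * ⟪v, z⟫ ^ k` over the vertices of `P`, for all `k ≥ 0`.

The triangulation (`exists_triangulation`) consists of the lower faces of a generic lifting of the
vertices: for almost every `x` in `P`, a linear functional on the representations of `x` as a
convex combination of the vertices is minimised by a representation supported on exactly one of
these simplices.

It remains to see that `B_v` does not vanish. Blowing up at `v` turns the triangulation into a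
decomposition of the cone of feasible directions at `v` into the cones of the simplices that
contain `v` (`ae_indicator_feasibleCone`). As `P` is simple, the former cone is spanned by the `d`
edge vectors at `v` (`subset_cone_of_edges`). The integral of `y ↦ exp ⟪y, z⟫` over a simplicial
cone is the coefficient in the formula above, up to sign, so for `z` in the interior of the polar
cone `B_v` is `±D_v(z)`. After multiplication by `∏_{u ≠ v} ⟪v - u, z⟫` this is an identity between
polynomials in `z`, hence it holds everywhere (`sum_simplexWeight_mul_prod`), and at `z` in general
position `B_v` is nonzero.

Finally, a Hankel matrix of power sums with distinct nodes and nonzero weights kills the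
coefficient vector of `q` if and only if `q` vanishes at all nodes, that is, if and only if
`p_z` divides `q` (`hankel_rank_and_ker`).
-/

/-! ### Hankel matrices of power sums -/

namespace InverseMoment

open Polynomial in
/-- Invertibility of the Vandermonde matrix, by Lagrange interpolation. -/
theorem eq_zero_of_sum_mul_pow_eq_zero {ι : Type*} {s : Finset ι} {x : ι → ℝ}
    (hx : Set.InjOn x s) {m : ℕ} (hm : s.card ≤ m) {b : ι → ℝ}
    (h : ∀ i < m, ∑ v ∈ s, b v * x v ^ i = 0) : ∀ v ∈ s, b v = 0 := by
  classical
  intro v hv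
  have key : ∀ q : ℝ[X], q.natDegree < m → ∑ u ∈ s, b u * q.eval (x u) = 0 := by
    intro q hq
    simp_rw [Polynomial.eval_eq_sum_range' hq, Finset.mul_sum]
    rw [Finset.sum_comm]
    refine Finset.sum_eq_zero fun i hi => ?_
    have := h i (Finset.mem_range.1 hi)
    calc ∑ u ∈ s, b u * (q.coeff i * x u ^ i) = q.coeff i * ∑ u ∈ s, b u * x u ^ i := by
          rw [Finset.mul_sum]; exact Finset.sum_congr rfl fun _ _ => by ring
      _ = 0 := by rw [this, mul_zero]
  have hc : 0 < s.card := Finset.card_pos.2 ⟨v, hv⟩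
  have h1 := key (Lagrange.basis s x v) (by
    rw [Polynomial.natDegree_eq_of_degree_eq_some (Lagrange.degree_basis hx hv)]; omega)
  rw [Finset.sum_eq_single_of_mem v hv] at h1
  · rwa [Lagrange.eval_basis_self hx hv, mul_one] at h1
  · intro u hu huv
    rw [Lagrange.eval_basis_of_ne huv.symm hu, mul_zero]

/-- The vector `a` of length `m`, read as the coefficients of a polynomial of degree `< m`. -/
noncomputable def vecPoly {m : ℕ} (a : Fin m → ℝ) : Polynomial ℝ :=
  ∑ j : Fin m, Polynomial.monomial (j : ℕ) (a j)

theorem vecPoly_eval {m : ℕ} (a : Fin m → ℝ) (t : ℝ) :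
    (vecPoly a).eval t = ∑ j : Fin m, a j * t ^ (j : ℕ) := by
  simp [vecPoly, Polynomial.eval_finsetSum]

theorem vecPoly_coeff {m : ℕ} (a : Fin m → ℝ) (j : Fin m) : (vecPoly a).coeff j = a j := by
  simp [vecPoly, Polynomial.coeff_monomial, Fin.val_inj]

theorem vecPoly_degree_lt {m : ℕ} (a : Fin m → ℝ) : (vecPoly a).degree < m := by
  refine lt_of_le_of_lt (Polynomial.degree_sum_le _ _) ?_
  refine (Finset.sup_lt_iff (WithBot.bot_lt_coe m)).2 fun j _ => ?_
  exact lt_of_le_of_lt (Polynomial.degree_monomial_le _ _) (Nat.cast_lt.2 j.2)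

theorem hankel_mulVec_eq_zero_iff {ι : Type*} {s : Finset ι} {x : ι → ℝ}
    (hx : Set.InjOn x s) {B : ι → ℝ} (hB : ∀ v ∈ s, B v ≠ 0) {c : ℕ → ℝ}
    (hc : ∀ k, c (k + 1) = ∑ v ∈ s, B v * x v ^ k) {m : ℕ} (hm : s.card ≤ m) (a : Fin m → ℝ) :
    (hankel c m).mulVec a = 0 ↔ ∀ v ∈ s, (vecPoly a).eval (x v) = 0 := by
  have key : ∀ i : Fin m, (hankel c m).mulVec a i =
      ∑ v ∈ s, (B v * (vecPoly a).eval (x v)) * x v ^ (i : ℕ) := by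
    intro i
    simp only [Matrix.mulVec, dotProduct, hankel, Matrix.of_apply, hc, vecPoly_eval,
      Finset.sum_mul, Finset.mul_sum]
    rw [Finset.sum_comm]
    exact Finset.sum_congr rfl fun v _ => Finset.sum_congr rfl fun j _ => by ring
  constructor
  · intro h v hv
    have := eq_zero_of_sum_mul_pow_eq_zero hx hm
      (b := fun v => B v * (vecPoly a).eval (x v)) (fun i hi => by
        rw [← key ⟨i, hi⟩, h]; rfl) v hv
    exact (mul_eq_zero.1 this).resolve_left (hB v hv)
  · intro h
    ext i
    rw [key]
    exact Finset.sum_eq_zero fun v hv => by rw [h v hv]; simp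

theorem shiftedCoeffs_eq_coeff (p : Polynomial ℝ) (m l : ℕ) (i : Fin m) :
    shiftedCoeffs p m l i = (Polynomial.X ^ l * p).coeff i := by
  rw [shiftedCoeffs, Polynomial.coeff_X_pow_mul']
  split_ifs with h1 h2 h2 <;> first | rfl | omega

theorem sum_smul_shiftedCoeffs (p : Polynomial ℝ) (m n : ℕ) (r : Fin n → ℝ) (i : Fin m) :
    (∑ l : Fin n, r l • shiftedCoeffs p m l) i = (vecPoly r * p).coeff i := by
  simp only [Finset.sum_apply, Pi.smul_apply, shiftedCoeffs_eq_coeff, vecPoly, Finset.sum_mul,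
    Polynomial.finsetSum_coeff, smul_eq_mul]
  refine Finset.sum_congr rfl fun l _ => ?_
  rw [← Polynomial.C_mul_X_pow_eq_monomial, mul_assoc, Polynomial.coeff_C_mul]

theorem linearIndependent_shiftedCoeffs {p : Polynomial ℝ} (hp : p ≠ 0) {m : ℕ}
    (hm : p.natDegree ≤ m) :
    LinearIndependent ℝ (fun l : Fin (m - p.natDegree) => shiftedCoeffs p m l) := by
  rw [Fintype.linearIndependent_iff]
  intro r hr l
  have h0 : vecPoly r * p = 0 := by
    ext i
    by_cases hi : i < m
    · rw [← sum_smul_shiftedCoeffs p m _ r ⟨i, hi⟩, hr]; simp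
    · rw [Polynomial.coeff_zero]
      refine Polynomial.coeff_eq_zero_of_degree_lt ?_
      by_cases hz : vecPoly r = 0
      · simp [hz]
      · rw [Polynomial.degree_mul, Polynomial.degree_eq_natDegree hp]
        have h2 := vecPoly_degree_lt r
        rw [Polynomial.degree_eq_natDegree hz] at h2 ⊢
        norm_cast at h2 ⊢
        omega
  have h1 : vecPoly r = 0 := (mul_eq_zero.1 h0).resolve_right hp
  rw [← vecPoly_coeff r l, h1, Polynomial.coeff_zero]

theorem vecPoly_mem_span_shiftedCoeffs {p : Polynomial ℝ} (hp : p ≠ 0) {m : ℕ}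
    {a : Fin m → ℝ} (h : p ∣ vecPoly a) :
    a ∈ Submodule.span ℝ
      (Set.range fun l : Fin (m - p.natDegree) => shiftedCoeffs p m l) := by
  obtain ⟨r, hr⟩ := h
  have hd : ∀ i, m - p.natDegree ≤ i → r.coeff i = 0 := by
    intro i hi
    by_contra hne
    have hr0 : r ≠ 0 := by rintro rfl; simp at hne
    have h1 := vecPoly_degree_lt a
    rw [hr, Polynomial.degree_mul, Polynomial.degree_eq_natDegree hp,
      Polynomial.degree_eq_natDegree hr0] at h1
    norm_cast at h1
    have := Polynomial.le_natDegree_of_ne_zero hne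
    omega
  have hr' : r = vecPoly (fun l : Fin (m - p.natDegree) => r.coeff l) := by
    ext i
    by_cases hi : i < m - p.natDegree
    · exact (vecPoly_coeff (fun l : Fin (m - p.natDegree) => r.coeff l) ⟨i, hi⟩).symm
    · rw [hd i (by omega)]
      refine (Polynomial.coeff_eq_zero_of_degree_lt
        (lt_of_lt_of_le (vecPoly_degree_lt _) ?_)).symm
      exact_mod_cast not_lt.1 hi
  have : a = ∑ l : Fin (m - p.natDegree), r.coeff l • shiftedCoeffs p m l := by
    ext i
    rw [sum_smul_shiftedCoeffs p m _ (fun l : Fin (m - p.natDegree) => r.coeff l), ← hr',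
      mul_comm, ← hr, vecPoly_coeff]
  rw [this]
  exact Submodule.sum_mem _ fun l _ =>
    Submodule.smul_mem _ _ (Submodule.subset_span ⟨l, rfl⟩)

/-- Rank and kernel of the Hankel matrix of the power sums `c (k + 1) = ∑ v, B v * x v ^ k` with
distinct nodes and nonzero weights: a vector is in the kernel if and only if the polynomial with
these coefficients vanishes at all nodes. -/
theorem hankel_rank_and_ker {ι : Type*} {s : Finset ι} {x : ι → ℝ}
    (hx : Set.InjOn x s) {B : ι → ℝ} (hB : ∀ v ∈ s, B v ≠ 0) {c : ℕ → ℝ}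
    (hc : ∀ k, c (k + 1) = ∑ v ∈ s, B v * x v ^ k) {m : ℕ} (hm : s.card ≤ m)
    {p : Polynomial ℝ} (hp : p = ∏ v ∈ s, (Polynomial.X - Polynomial.C (x v))) :
    (hankel c m).rank = s.card ∧
    LinearIndependent ℝ (fun l : Fin (m - s.card) => shiftedCoeffs p m l) ∧
    LinearMap.ker (hankel c m).mulVecLin =
      Submodule.span ℝ (Set.range (fun l : Fin (m - s.card) => shiftedCoeffs p m l)) := by
  have hdeg : p.natDegree = s.card := by
    rw [hp]; exact Polynomial.natDegree_finsetProd_X_sub_C_eq_card s x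
  have hp0 : p ≠ 0 := by
    rw [hp]; exact (Polynomial.monic_prod_of_monic _ _ fun v _ =>
      Polynomial.monic_X_sub_C (x v)).ne_zero
  have hroot : ∀ v ∈ s, p.eval (x v) = 0 := by
    intro v hv
    rw [hp, Polynomial.eval_prod]
    exact Finset.prod_eq_zero hv (by simp)
  have hLI := linearIndependent_shiftedCoeffs hp0 (m := m) (hdeg ▸ hm)
  have hker : LinearMap.ker (hankel c m).mulVecLin =
      Submodule.span ℝ (Set.range (fun l : Fin (m - p.natDegree) => shiftedCoeffs p m l)) := by
    apply le_antisymm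
    · intro a ha
      rw [LinearMap.mem_ker, Matrix.mulVecLin_apply, hankel_mulVec_eq_zero_iff hx hB hc hm] at ha
      refine vecPoly_mem_span_shiftedCoeffs hp0 ?_
      rw [hp]
      refine Finset.prod_dvd_of_coprime ?_ fun v hv => Polynomial.dvd_iff_isRoot.2 (ha v hv)
      intro u hu v hv huv
      exact Polynomial.isCoprime_X_sub_C_of_isUnit_sub
        (sub_ne_zero.2 fun h => huv (hx hu hv h)).isUnit
    · rw [Submodule.span_le]
      rintro _ ⟨l, rfl⟩
      rw [SetLike.mem_coe, LinearMap.mem_ker, Matrix.mulVecLin_apply,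
        hankel_mulVec_eq_zero_iff hx hB hc hm]
      intro v hv
      have : vecPoly (shiftedCoeffs p m l) = Polynomial.X ^ (l : ℕ) * p := by
        ext i
        by_cases hi : i < m
        · rw [← shiftedCoeffs_eq_coeff p m l ⟨i, hi⟩]
          exact vecPoly_coeff (shiftedCoeffs p m l) ⟨i, hi⟩
        · rw [Polynomial.coeff_eq_zero_of_degree_lt, Polynomial.coeff_eq_zero_of_degree_lt]
          · rw [Polynomial.degree_mul, Polynomial.degree_X_pow, Polynomial.degree_eq_natDegree hp0]
            norm_cast
            have := l.2
            omega
          · exact lt_of_lt_of_le (vecPoly_degree_lt _) (by exact_mod_cast not_lt.1 hi)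
      rw [this, Polynomial.eval_mul, hroot v hv, mul_zero]
  rw [hdeg] at hLI hker
  refine ⟨?_, hLI, hker⟩
  have h1 := LinearMap.finrank_range_add_finrank_ker (hankel c m).mulVecLin
  rw [hker, finrank_span_eq_card hLI] at h1
  simp only [Fintype.card_fin, Module.finrank_fintype_fun_eq_card] at h1
  rw [Matrix.rank]
  omega

/-! ### Regular triangulations -/

section Triangulation

variable {E : Type*} [NormedAddCommGroup E] [NormedSpace ℝ E]

/-- The finite set `σ` is the vertex set of a full-dimensional simplex. -/
def IsFullSimplex (σ : Finset E) : Prop :=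
  AffineIndependent ℝ ((↑) : σ → E) ∧ σ.card = Module.finrank ℝ E + 1

/-- The ways of writing `x` as a convex combination of the points of `s`; the weights are
functions on the whole space that vanish outside `s`. -/
def convexWeights (s : Finset E) (x : E) : Set (E → ℝ) :=
  {w | (∀ u ∉ s, w u = 0) ∧ (∀ u ∈ s, 0 ≤ w u) ∧ ∑ u ∈ s, w u = 1 ∧ ∑ u ∈ s, w u • u = x}

theorem convexWeights_nonempty {s : Finset E} {x : E} (hx : x ∈ convexHull ℝ (s : Set E)) :
    (convexWeights s x).Nonempty := by
  classical
  obtain ⟨w, h0, h1, h2⟩ := Finset.mem_convexHull'.1 hx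
  refine ⟨fun u => if u ∈ s then w u else 0, fun u hu => by simp [hu],
    fun u hu => by simpa [hu] using h0 u hu, ?_, ?_⟩
  · rw [← h1]; exact Finset.sum_congr rfl fun u hu => by simp [hu]
  · rw [← h2]; exact Finset.sum_congr rfl fun u hu => by simp [hu]

theorem isCompact_convexWeights (s : Finset E) (x : E) : IsCompact (convexWeights s x) := by
  have hsub : convexWeights s x ⊆ Set.univ.pi fun _ : E => Set.Icc (0 : ℝ) 1 := by
    rintro w ⟨h0, h1, h2, -⟩ u -
    by_cases hu : u ∈ s
    · exact ⟨h1 u hu, h2 ▸ Finset.single_le_sum h1 hu⟩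
    · rw [h0 u hu]; simp
  refine (isCompact_univ_pi fun _ => isCompact_Icc).of_isClosed_subset ?_ hsub
  have e : convexWeights s x = (⋂ u, ⋂ (_ : u ∉ s), {w : E → ℝ | w u = 0}) ∩
      ((⋂ u, ⋂ (_ : u ∈ s), {w : E → ℝ | 0 ≤ w u}) ∩
      ({w : E → ℝ | ∑ u ∈ s, w u = 1} ∩ {w : E → ℝ | ∑ u ∈ s, w u • u = x})) := by
    ext w; simp [convexWeights]
  rw [e]
  refine IsClosed.inter (isClosed_iInter fun u => isClosed_iInter fun _ => ?_)
    (IsClosed.inter (isClosed_iInter fun u => isClosed_iInter fun _ => ?_) (IsClosed.inter ?_ ?_))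
  · exact isClosed_eq (continuous_apply u) continuous_const
  · exact isClosed_le continuous_const (continuous_apply u)
  · exact isClosed_eq (by fun_prop) continuous_const
  · exact isClosed_eq (by fun_prop) continuous_const

/-- A direction along which the constraints of `convexWeights s x` are preserved, and which does
not decrease the vanishing weights, can be followed for some time. -/
theorem exists_add_smul_mem_convexWeights {s : Finset E} {x : E} {w μ : E → ℝ}
    (hw : w ∈ convexWeights s x) (h0 : ∀ u ∉ s, μ u = 0) (h1 : ∑ u ∈ s, μ u = 0)
    (h2 : ∑ u ∈ s, μ u • u = 0) (hpos : ∀ u ∈ s, w u = 0 → 0 ≤ μ u) :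
    ∀ᶠ ε in nhdsWithin (0 : ℝ) (Set.Ioi 0), w + ε • μ ∈ convexWeights s x := by
  have key : ∀ᶠ ε in nhdsWithin (0 : ℝ) (Set.Ioi 0), ∀ u ∈ s, 0 ≤ w u + ε * μ u := by
    rw [Finset.eventually_all]
    intro u hu
    rcases (hw.2.1 u hu).eq_or_lt with h | h
    · filter_upwards [self_mem_nhdsWithin] with ε hε
      rw [← h, zero_add]
      exact mul_nonneg (le_of_lt hε) (hpos u hu h.symm)
    · have hc : Filter.Tendsto (fun ε : ℝ => w u + ε * μ u) (nhdsWithin 0 (Set.Ioi 0))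
          (nhds (w u + 0 * μ u)) :=
        ((by fun_prop : Continuous fun ε : ℝ => w u + ε * μ u).tendsto 0).mono_left
          nhdsWithin_le_nhds
      rw [zero_mul, add_zero] at hc
      filter_upwards [hc.eventually (lt_mem_nhds h)] with ε hε using hε.le
  filter_upwards [key] with ε hε
  refine ⟨fun u hu => by simp [hw.1 u hu, h0 u hu], fun u hu => by simpa using hε u hu, ?_, ?_⟩
  · simp [Finset.sum_add_distrib, ← Finset.mul_sum, h1, hw.2.2.1]
  · simp [add_smul, mul_smul, Finset.sum_add_distrib, ← Finset.smul_sum, h2, hw.2.2.2]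

/-- Minimising a linear functional over the representations of `x` as a convex combination of `s`,
there is a minimiser with affinely independent support. -/
theorem exists_minimal_convexWeights (s : Finset E) (h : E → ℝ) {x : E}
    (hx : x ∈ convexHull ℝ (s : Set E)) :
    ∃ w ∈ convexWeights s x,
      (∀ w' ∈ convexWeights s x, ∑ u ∈ s, w u * h u ≤ ∑ u ∈ s, w' u * h u) ∧
      AffineIndependent ℝ ((↑) : (s.filter fun u => w u ≠ 0) → E) := by
  classical
  set F := convexWeights s x with hF
  let obj : (E → ℝ) → ℝ := fun w => ∑ u ∈ s, w u * h u
  have hobj : Continuous obj := by fun_prop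
  have hFc : IsCompact F := isCompact_convexWeights s x
  obtain ⟨w₀, hw₀, hmin⟩ := hFc.exists_isMinOn (convexWeights_nonempty hx) hobj.continuousOn
  let G := F ∩ {w | obj w = obj w₀}
  have hGc : IsCompact G := hFc.inter_right (isClosed_eq hobj continuous_const)
  obtain ⟨w, hw⟩ := hGc.extremePoints_nonempty ⟨w₀, hw₀, rfl⟩
  refine ⟨w, hw.1.1, fun w' hw' => ?_, ?_⟩
  · have := isMinOn_iff.1 hmin w' hw'
    have h2 : obj w = obj w₀ := hw.1.2
    exact h2.trans_le this
  · by_contra hdep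
    obtain ⟨f, hf1, hf2, u₀, hu₀, hfu₀⟩ := exists_nontrivial_relation_sum_zero_of_not_affine_ind hdep
    let μ : E → ℝ := fun u => if u ∈ s.filter (fun u => w u ≠ 0) then f u else 0
    have hμ0 : ∀ u ∉ s, μ u = 0 := fun u hu => by simp [μ, hu]
    have hμ1 : ∑ u ∈ s, μ u = 0 := by
      rw [← hf2, Finset.sum_filter]
      exact Finset.sum_congr rfl fun u hu => by simp [μ, hu]
    have hμ2 : ∑ u ∈ s, μ u • u = 0 := by
      rw [← hf1, Finset.sum_filter]
      refine Finset.sum_congr rfl fun u hu => ?_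
      by_cases hwu : w u = 0 <;> simp [μ, hu, hwu]
    have hμz : ∀ u, w u = 0 → μ u = 0 := fun u hu => by simp [μ, hu]
    have e1 := exists_add_smul_mem_convexWeights hw.1.1 hμ0 hμ1 hμ2
      fun u _ hu => (hμz u hu).ge
    have e2 := exists_add_smul_mem_convexWeights (μ := -μ) hw.1.1 (by simpa using hμ0)
      (by simpa using hμ1) (by simpa using hμ2) fun u _ hu => by simp [hμz u hu]
    obtain ⟨ε, ⟨h1, h2⟩, hε⟩ := ((e1.and e2).and self_mem_nhdsWithin).exists
    have hε : 0 < ε := hε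
    have o1 : obj (w + ε • μ) = obj w + ε * obj μ := by
      simp [obj, add_mul, Finset.sum_add_distrib, Finset.mul_sum, mul_assoc]
    have o2 : obj (w + ε • -μ) = obj w - ε * obj μ := by
      simp [obj, add_mul, Finset.sum_add_distrib, Finset.mul_sum, mul_assoc, sub_eq_add_neg]
    have hw2 : obj w = obj w₀ := hw.1.2
    have m1 : obj w₀ ≤ obj (w + ε • μ) := isMinOn_iff.1 hmin _ h1
    have m2 : obj w₀ ≤ obj (w + ε • -μ) := isMinOn_iff.1 hmin _ h2
    have hz : ε * obj μ = 0 := by linarith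
    have g1 : w + ε • μ ∈ G := ⟨h1, by simp only [Set.mem_ofPred_eq]; linarith⟩
    have g2 : w + ε • -μ ∈ G := ⟨h2, by simp only [Set.mem_ofPred_eq]; linarith⟩
    have hseg : w ∈ openSegment ℝ (w + ε • μ) (w + ε • -μ) := by
      refine ⟨1 / 2, 1 / 2, by norm_num, by norm_num, by norm_num, ?_⟩
      ext u
      simp
      ring
    have := congrFun (hw.2 g1 g2 hseg) u₀
    have hmem : μ u₀ = f u₀ := by simp only [μ, if_pos hu₀]
    simp only [Pi.add_apply, Pi.smul_apply, smul_eq_mul, hmem] at this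
    have : ε * f u₀ = 0 := by linarith
    exact (mul_ne_zero hε.ne' hfu₀) this

theorem affineMap_sum_smul (ℓ : E →ᵃ[ℝ] ℝ) {s : Finset E} {w : E → ℝ} (hw : ∑ u ∈ s, w u = 1) :
    ℓ (∑ u ∈ s, w u • u) = ∑ u ∈ s, w u * ℓ u := by
  have h : ∀ u, ℓ u = ℓ.linear u + ℓ 0 := fun u => by
    simpa using congrFun (AffineMap.decomp ℓ) u
  have e : ∑ u ∈ s, w u * ℓ u = ∑ u ∈ s, (w u * ℓ.linear u + w u * ℓ 0) :=
    Finset.sum_congr rfl fun u _ => by rw [h u, mul_add]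
  rw [h, map_sum, e, Finset.sum_add_distrib, ← Finset.sum_mul, hw, one_mul]
  simp

theorem IsFullSimplex.affineSpan_eq_top [FiniteDimensional ℝ E] {σ : Finset E}
    (hσ : IsFullSimplex σ) : affineSpan ℝ (σ : Set E) = ⊤ := by
  have := (hσ.1.affineSpan_eq_top_iff_card_eq_finrank_add_one).2 (by simpa using hσ.2)
  simpa using this

/-- Barycentric coordinates with respect to a full-dimensional simplex. -/
theorem IsFullSimplex.exists_coords [FiniteDimensional ℝ E] {σ : Finset E}
    (hσ : IsFullSimplex σ) (x : E) :
    ∃ w : E → ℝ, (∀ u ∉ σ, w u = 0) ∧ ∑ u ∈ σ, w u = 1 ∧ ∑ u ∈ σ, w u • u = x := by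
  classical
  let b : AffineBasis σ ℝ E := ⟨(↑), hσ.1, by simpa using hσ.affineSpan_eq_top⟩
  refine ⟨fun u => if hu : u ∈ σ then b.coord ⟨u, hu⟩ x else 0, fun u hu => by simp [hu], ?_, ?_⟩
  · rw [← b.sum_coord_apply_eq_one x, ← Finset.sum_coe_sort]
    exact Finset.sum_congr rfl fun u _ => by simp
  · conv_rhs => rw [← b.linear_combination_coord_eq_self x]
    rw [← Finset.sum_coe_sort]
    refine Finset.sum_congr rfl fun u _ => ?_
    have hb : b u = u := rfl
    simp [hb]

/-- An affine function can be prescribed on the vertices of a full-dimensional simplex. -/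
theorem IsFullSimplex.exists_affineMap [FiniteDimensional ℝ E] {σ : Finset E}
    (hσ : IsFullSimplex σ) (h : E → ℝ) : ∃ ℓ : E →ᵃ[ℝ] ℝ, ∀ u ∈ σ, ℓ u = h u := by
  classical
  let b : AffineBasis σ ℝ E := ⟨(↑), hσ.1, by simpa using hσ.affineSpan_eq_top⟩
  refine ⟨∑ i : σ, h i • b.coord i, fun u hu => ?_⟩
  have hb : b ⟨u, hu⟩ = u := rfl
  have e : (∑ i : σ, h i • b.coord i) u = ∑ i : σ, h i * b.coord i u := by
    have : ∀ t : Finset σ, (∑ i ∈ t, h i • b.coord i) u = ∑ i ∈ t, h i * b.coord i u := by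
      intro t
      induction t using Finset.induction_on with
      | empty => simp
      | insert a t ha ih => simp [Finset.sum_insert ha, ih]
    exact this _
  have hc : ∀ i, b.coord i u = if i = ⟨u, hu⟩ then 1 else 0 := fun i => by
    rw [← b.coord_apply i ⟨u, hu⟩, hb]
  rw [e, Finset.sum_congr rfl fun i _ => by rw [hc i]]
  simp

/-- Heights in general position: no `dim E + 2` of the lifted points lie on a common non-vertical
hyperplane. -/
theorem exists_generic_height [FiniteDimensional ℝ E] (s : Finset E) :
    ∃ h : E → ℝ, ∀ σ ⊆ s, IsFullSimplex σ → ∀ u ∈ s, u ∉ σ → ∀ ℓ : E →ᵃ[ℝ] ℝ,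
      (∀ v ∈ σ, ℓ v = h v) → ℓ u ≠ h u := by
  classical
  let I := {q : Finset E × E // (q.1 ⊆ s ∧ q.2 ∈ s) ∧ IsFullSimplex q.1 ∧ q.2 ∉ q.1}
  have hI : Finite I := by
    refine Set.Finite.to_subtype (Set.Finite.subset (s.powerset ×ˢ s).finite_toSet ?_)
    rintro q ⟨⟨h1, h2⟩, -⟩
    simp [h1, h2]
  let V : I → Subspace ℝ (E → ℝ) := fun q =>
    { carrier := {h | ∃ ℓ : E →ᵃ[ℝ] ℝ, (∀ v ∈ q.1.1, ℓ v = h v) ∧ ℓ q.1.2 = h q.1.2}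
      add_mem' := by
        rintro a b ⟨ℓ, h1, h2⟩ ⟨ℓ', h1', h2'⟩
        exact ⟨ℓ + ℓ', fun v hv => by simp [h1 v hv, h1' v hv], by simp [h2, h2']⟩
      zero_mem' := ⟨0, by simp, by simp⟩
      smul_mem' := by
        rintro c a ⟨ℓ, h1, h2⟩
        exact ⟨c • ℓ, fun v hv => by simp [h1 v hv], by simp [h2]⟩ }
  have hV : ⋃ q, (V q : Set (E → ℝ)) ≠ Set.univ := by
    intro hu
    obtain ⟨q, hq⟩ := Subspace.exists_eq_top_of_iUnion_eq_univ hu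
    have : (fun u => if u = q.1.2 then (1 : ℝ) else 0) ∈ V q := hq ▸ Submodule.mem_top
    obtain ⟨ℓ, h1, h2⟩ := this
    have h0 : ℓ = 0 := AffineMap.ext_on q.2.2.1.affineSpan_eq_top fun v hv => by
      have hne : v ≠ q.1.2 := fun e => q.2.2.2 (e ▸ hv)
      rw [h1 v hv]
      simp [hne]
    simp [h0] at h2
  obtain ⟨h, hh⟩ := (Set.ne_univ_iff_exists_notMem _).1 hV
  rw [Set.mem_iUnion] at hh
  push Not at hh
  exact ⟨h, fun σ hσs hσ u hu huσ ℓ hℓ he => hh ⟨(σ, u), ⟨hσs, hu⟩, hσ, huσ⟩ ⟨ℓ, hℓ, he⟩⟩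

/-- `σ` is a lower simplex of `s` for the heights `h`: the affine function interpolating `h` on `σ`
lies strictly below `h` on the rest of `s`. -/
def IsLower (s : Finset E) (h : E → ℝ) (σ : Finset E) : Prop :=
  ∃ ℓ : E →ᵃ[ℝ] ℝ, (∀ u ∈ σ, ℓ u = h u) ∧ ∀ u ∈ s, u ∉ σ → ℓ u < h u

/-- Two lower simplices meet in the convex hull of their common vertices: at a common point `x`,
both interpolating functions take the least value of `∑ w_u h_u` over the representations
`x = ∑ w_u u` as a convex combination of `s`. -/
theorem IsLower.mem_convexHull_inter [DecidableEq E] {s σ τ : Finset E} {h : E → ℝ}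
    (hσs : σ ⊆ s) (hτs : τ ⊆ s)
    (hσ : IsLower s h σ) (hτ : IsLower s h τ) {x : E} (hxσ : x ∈ convexHull ℝ (σ : Set E))
    (hxτ : x ∈ convexHull ℝ (τ : Set E)) : x ∈ convexHull ℝ ((σ ∩ τ : Finset E) : Set E) := by
  obtain ⟨ℓ, hℓ1, hℓ2⟩ := hσ
  obtain ⟨k, hk1, hk2⟩ := hτ
  obtain ⟨a, ha0, ha1, rfl⟩ := Finset.mem_convexHull'.1 hxσ
  obtain ⟨b, hb0, hb1, hb⟩ := Finset.mem_convexHull'.1 hxτ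
  have kle : ∀ u ∈ σ, a u * k u ≤ a u * h u := fun u hu => by
    by_cases hu' : u ∈ τ
    · rw [hk1 u hu']
    · exact mul_le_mul_of_nonneg_left (hk2 u (hσs hu) hu').le (ha0 u hu)
  have lle : ∀ u ∈ τ, b u * ℓ u ≤ b u * h u := fun u hu => by
    by_cases hu' : u ∈ σ
    · rw [hℓ1 u hu']
    · exact mul_le_mul_of_nonneg_left (hℓ2 u (hτs hu) hu').le (hb0 u hu)
  have e1 : ∑ u ∈ σ, a u * h u = ℓ (∑ u ∈ σ, a u • u) := by
    rw [affineMap_sum_smul ℓ ha1]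
    exact Finset.sum_congr rfl fun u hu => by rw [hℓ1 u hu]
  have e2 : ∑ u ∈ τ, b u * h u = k (∑ u ∈ σ, a u • u) := by
    rw [← hb, affineMap_sum_smul k hb1]
    exact Finset.sum_congr rfl fun u hu => by rw [hk1 u hu]
  have i1 : k (∑ u ∈ σ, a u • u) ≤ ∑ u ∈ σ, a u * h u := by
    rw [affineMap_sum_smul k ha1]; exact Finset.sum_le_sum kle
  have i2 : ℓ (∑ u ∈ σ, a u • u) ≤ ∑ u ∈ τ, b u * h u := by
    rw [← hb, affineMap_sum_smul ℓ hb1]; exact Finset.sum_le_sum lle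
  have eq : ∑ u ∈ σ, a u * k u = ∑ u ∈ σ, a u * h u := by
    rw [← affineMap_sum_smul k ha1]
    linarith
  have hz : ∀ u ∈ σ, u ∉ τ → a u = 0 := fun u hu hu' => by
    have h1 := (Finset.sum_eq_sum_iff_of_le kle).1 eq u hu
    have h2 := hk2 u (hσs hu) hu'
    by_contra hne
    exact h2.ne (mul_left_cancel₀ hne h1)
  refine Finset.mem_convexHull'.2 ⟨a, fun u hu => ha0 u (Finset.mem_inter.1 hu).1, ?_, ?_⟩
  · rw [← ha1]
    refine Finset.sum_subset Finset.inter_subset_left fun u hu hu' => hz u hu ?_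
    exact fun h => hu' (Finset.mem_inter.2 ⟨hu, h⟩)
  · refine Finset.sum_subset Finset.inter_subset_left fun u hu hu' => ?_
    rw [hz u hu fun h => hu' (Finset.mem_inter.2 ⟨hu, h⟩), zero_smul]

/-- A point in general position lies in a lower simplex, the support of a representation
`x = ∑ w_u u` that minimises `∑ w_u h_u`. -/
theorem exists_lower_simplex [FiniteDimensional ℝ E] {s : Finset E} {h : E → ℝ}
    (hh : ∀ σ ⊆ s, IsFullSimplex σ → ∀ u ∈ s, u ∉ σ → ∀ ℓ : E →ᵃ[ℝ] ℝ,
      (∀ v ∈ σ, ℓ v = h v) → ℓ u ≠ h u)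
    {x : E} (hx : x ∈ convexHull ℝ (s : Set E))
    (hgen : ∀ τ ⊆ s, τ.card ≤ Module.finrank ℝ E → x ∉ convexHull ℝ (τ : Set E)) :
    ∃ σ ⊆ s, IsFullSimplex σ ∧ IsLower s h σ ∧ x ∈ convexHull ℝ (σ : Set E) := by
  classical
  obtain ⟨w, hw, hmin, hind⟩ := exists_minimal_convexWeights s h hx
  set σ := s.filter fun u => w u ≠ 0 with hσdef
  have hσs : σ ⊆ s := Finset.filter_subset _ _
  have hw0 : ∀ u ∈ s, u ∉ σ → w u = 0 := fun u hu hu' => by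
    by_contra hne
    exact hu' (Finset.mem_filter.2 ⟨hu, hne⟩)
  have hxσ : x ∈ convexHull ℝ (σ : Set E) := by
    refine Finset.mem_convexHull'.2 ⟨w, fun u hu => hw.2.1 u (hσs hu), ?_, ?_⟩
    · rw [← hw.2.2.1]; exact Finset.sum_subset hσs hw0
    · rw [← hw.2.2.2]
      exact Finset.sum_subset hσs fun u hu hu' => by rw [hw0 u hu hu', zero_smul]
  have hcard : σ.card = Module.finrank ℝ E + 1 := by
    have h1 := hind.card_le_finrank_succ
    rw [Fintype.card_coe] at h1
    have h2 : Module.finrank ℝ (vectorSpan ℝ (Set.range ((↑) : σ → E))) ≤ Module.finrank ℝ E :=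
      Submodule.finrank_le _
    have h3 : ¬ σ.card ≤ Module.finrank ℝ E := fun hle => hgen σ hσs hle hxσ
    omega
  have hfull : IsFullSimplex σ := ⟨hind, hcard⟩
  obtain ⟨ℓ, hℓ⟩ := hfull.exists_affineMap h
  refine ⟨σ, hσs, hfull, ⟨ℓ, hℓ, fun u hu hu' => ?_⟩, hxσ⟩
  refine lt_of_le_of_ne ?_ (hh σ hσs hfull u hu hu' ℓ hℓ)
  obtain ⟨c, hc0, hc1, hc2⟩ := hfull.exists_coords u
  have sub : ∀ f : E → ℝ, ∑ v ∈ s, (Pi.single u 1 - c : E → ℝ) v * f v =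
      f u - ∑ v ∈ σ, c v * f v := fun f => by
    rw [Finset.sum_subset hσs (f := fun v => c v * f v) fun v _ hv => by rw [hc0 v hv, zero_mul]]
    simp only [Pi.sub_apply, sub_mul, Finset.sum_sub_distrib, Pi.single_apply, ite_mul, one_mul,
      zero_mul]
    rw [Finset.sum_ite_eq' s u, if_pos hu]
  -- Shift weight from the vertices of `σ` to `u`, along the barycentric coordinates `c` of `u`.
  have ev := exists_add_smul_mem_convexWeights (μ := Pi.single u 1 - c) hw
    (fun v hv => by
      have : v ≠ u := fun e => hv (e ▸ hu)
      simp [this, hc0 v fun hvσ => hv (hσs hvσ)])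
    (by simpa [hc1] using sub 1)
    (by
      have e : ∑ v ∈ s, c v • v = u := by
        rw [← Finset.sum_subset hσs fun v _ hv => by rw [hc0 v hv, zero_smul], hc2]
      simp only [Pi.sub_apply, sub_smul, Finset.sum_sub_distrib, e, Pi.single_apply, ite_smul,
        one_smul, zero_smul]
      rw [Finset.sum_ite_eq' s u, if_pos hu, sub_self])
    (fun v hv hv0 => by
      have : v ∉ σ := fun h => (Finset.mem_filter.1 h).2 hv0
      by_cases e : v = u <;> simp [e, hc0 v this, hc0 u hu'])
  obtain ⟨ε, h1, hε⟩ := (ev.and self_mem_nhdsWithin).exists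
  have hε : 0 < ε := hε
  have h2 := hmin _ h1
  have h3 : ∑ v ∈ s, (w + ε • (Pi.single u 1 - c) : E → ℝ) v * h v =
      ∑ v ∈ s, w v * h v + ε * (h u - ℓ u) := by
    have : ℓ u = ∑ v ∈ σ, c v * h v := by
      conv_lhs => rw [← hc2]
      rw [affineMap_sum_smul ℓ hc1]
      exact Finset.sum_congr rfl fun v hv => by rw [hℓ v hv]
    rw [this, ← sub h, Finset.mul_sum, ← Finset.sum_add_distrib]
    refine Finset.sum_congr rfl fun v _ => ?_
    simp only [Pi.add_apply, Pi.smul_apply, smul_eq_mul]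
    ring
  rw [h3] at h2
  have : 0 ≤ ε * (h u - ℓ u) := by linarith
  linarith [nonneg_of_mul_nonneg_right this hε]

open MeasureTheory in
theorem measure_convexHull_eq_zero_of_card_le [FiniteDimensional ℝ E] [MeasurableSpace E]
    [BorelSpace E] (ν : Measure E) [ν.IsAddHaarMeasure] {τ : Finset E}
    (hτ : τ.card ≤ Module.finrank ℝ E) : ν (convexHull ℝ (τ : Set E)) = 0 := by
  refine measure_mono_null (convexHull_subset_affineSpan _)
    (Measure.addHaar_affineSubspace ν _ fun htop => ?_)
  rcases τ.eq_empty_or_nonempty with rfl | hne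
  · simp at htop
  · have h1 := finrank_vectorSpan_range_le ℝ ((↑) : τ → E) (n := τ.card - 1) (by
      have := hne.card_pos
      rw [Fintype.card_coe]; omega)
    have h2 : vectorSpan ℝ (Set.range ((↑) : τ → E)) = ⊤ := by
      have := AffineSubspace.vectorSpan_eq_top_of_affineSpan_eq_top ℝ E E htop
      simpa using this
    rw [h2, finrank_top] at h1
    have := hne.card_pos
    omega

open MeasureTheory in
/-- Regular triangulation: up to a null set, the convex hull of a finite set is partitioned into
full-dimensional simplices with vertices in this set. -/
theorem exists_triangulation [FiniteDimensional ℝ E] [MeasurableSpace E]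
    [BorelSpace E] (ν : Measure E) [ν.IsAddHaarMeasure] (s : Finset E) :
    ∃ T : Finset (Finset E), (∀ σ ∈ T, σ ⊆ s ∧ IsFullSimplex σ) ∧
      ∀ᵐ x ∂ν, (convexHull ℝ (s : Set E)).indicator (1 : E → ℝ) x =
        ∑ σ ∈ T, (convexHull ℝ (σ : Set E)).indicator (1 : E → ℝ) x := by
  classical
  obtain ⟨h, hh⟩ := exists_generic_height s
  refine ⟨s.powerset.filter fun σ => IsFullSimplex σ ∧ IsLower s h σ, fun σ hσ => ?_, ?_⟩
  · simp only [Finset.mem_filter, Finset.mem_powerset] at hσ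
    exact ⟨hσ.1, hσ.2.1⟩
  have hnull : ∀ᵐ x ∂ν, ∀ τ ∈ s.powerset, τ.card ≤ Module.finrank ℝ E →
      x ∉ convexHull ℝ (τ : Set E) := by
    rw [Filter.eventually_all_finset]
    intro τ _
    by_cases hτ : τ.card ≤ Module.finrank ℝ E
    · filter_upwards [measure_eq_zero_iff_ae_notMem.1
        (measure_convexHull_eq_zero_of_card_le ν hτ)] with x hx _ using hx
    · exact Filter.Eventually.of_forall fun x h => absurd h hτ
  filter_upwards [hnull] with x hx
  by_cases hxs : x ∈ convexHull ℝ (s : Set E)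
  · obtain ⟨σ, hσs, hσ, hlow, hxσ⟩ := exists_lower_simplex hh hxs
      fun τ hτ => hx τ (Finset.mem_powerset.2 hτ)
    rw [Set.indicator_of_mem hxs, Finset.sum_eq_single_of_mem σ
      (by simp [hσs, hσ, hlow]), Set.indicator_of_mem hxσ]
    intro τ hτ hne
    simp only [Finset.mem_filter, Finset.mem_powerset] at hτ
    refine Set.indicator_of_notMem (fun hxτ => ?_) _
    have h1 := hlow.mem_convexHull_inter hσs hτ.1 hτ.2.2 hxσ hxτ
    refine hx (σ ∩ τ) (Finset.mem_powerset.2 (Finset.inter_subset_left.trans hσs)) ?_ h1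
    have hlt : σ ∩ τ ⊂ σ := by
      refine Finset.inter_subset_left.ssubset_of_ne fun e => ?_
      have hsub : σ ⊆ τ := Finset.inter_eq_left.1 e
      exact hne (Finset.eq_of_subset_of_card_le hsub (by rw [hσ.2, hτ.2.1.2])).symm
    have := Finset.card_lt_card hlt
    rw [hσ.2] at this
    omega
  · rw [Set.indicator_of_notMem hxs, Finset.sum_eq_zero]
    intro σ hσ
    simp only [Finset.mem_filter, Finset.mem_powerset] at hσ
    exact Set.indicator_of_notMem (fun hxσ => hxs
      (convexHull_mono (Finset.coe_subset.2 hσ.1) hxσ)) _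

end Triangulation

/-! ### The Hermite–Genocchi formula -/

section Corner

open MeasureTheory

/-- The standard corner simplex in `ℝ ^ n`. -/
def corner (n : ℕ) : Set (Fin n → ℝ) := {t | (∀ i, 0 ≤ t i) ∧ ∑ i, t i ≤ 1}

theorem isCompact_corner (n : ℕ) : IsCompact (corner n) := by
  have hsub : corner n ⊆ Set.univ.pi fun _ => Set.Icc (0 : ℝ) 1 := by
    rintro t ⟨h0, h1⟩ i -
    exact ⟨h0 i, (Finset.single_le_sum (fun j _ => h0 j) (Finset.mem_univ i)).trans h1⟩
  refine (isCompact_univ_pi fun _ => isCompact_Icc).of_isClosed_subset ?_ hsub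
  have e : corner n = (⋂ i, {t : Fin n → ℝ | 0 ≤ t i}) ∩ {t | ∑ i, t i ≤ 1} := by
    ext; simp [corner]
  rw [e]
  exact (isClosed_iInter fun i => isClosed_le continuous_const (continuous_apply i)).inter
    (isClosed_le (by fun_prop) continuous_const)

theorem measurableSet_corner (n : ℕ) : MeasurableSet (corner n) :=
  (isCompact_corner n).isClosed.measurableSet

theorem cons_mem_corner_iff {n : ℕ} {r : ℝ} {u : Fin n → ℝ} :
    (Fin.cons r u : Fin (n + 1) → ℝ) ∈ corner (n + 1) ↔
      u ∈ corner n ∧ r ∈ Set.Icc 0 (1 - ∑ i, u i) := by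
  simp only [corner, Set.mem_ofPred_eq, Fin.forall_fin_succ, Fin.cons_zero, Fin.cons_succ,
    Fin.sum_univ_succ, Set.mem_Icc]
  constructor
  · rintro ⟨⟨h1, h2⟩, h3⟩
    exact ⟨⟨h2, by linarith⟩, h1, by linarith⟩
  · rintro ⟨⟨h1, h2⟩, h3, h4⟩
    exact ⟨⟨h3, h1⟩, by linarith⟩

theorem integral_corner_succ {n : ℕ} {F : (Fin (n + 1) → ℝ) → ℝ} (hF : Continuous F) :
    ∫ t in corner (n + 1), F t =
      ∫ u in corner n, ∫ r in (0 : ℝ)..(1 - ∑ i, u i), F (Fin.cons r u) := by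
  have hmp := (volume_preserving_piFinSuccAbove (fun _ : Fin (n + 1) => ℝ) 0).symm
  have hint : Integrable ((corner (n + 1)).indicator F) :=
    (integrable_indicator_iff (measurableSet_corner _)).2
      (hF.continuousOn.integrableOn_compact (isCompact_corner _))
  have hcons : ∀ q : ℝ × (Fin n → ℝ),
      (MeasurableEquiv.piFinSuccAbove (fun _ : Fin (n + 1) => ℝ) 0).symm q =
        Fin.cons q.1 q.2 := fun q => by
    simp [MeasurableEquiv.piFinSuccAbove, Fin.insertNthEquiv]
  rw [← integral_indicator (measurableSet_corner _), ← integral_indicator (measurableSet_corner _),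
    ← hmp.integral_comp' ((corner (n + 1)).indicator F)]
  have hint2 := hmp.integrable_comp_of_integrable hint
  have e : ((corner (n + 1)).indicator F) ∘
      (MeasurableEquiv.piFinSuccAbove (fun _ : Fin (n + 1) => ℝ) 0).symm =
      fun q => (corner (n + 1)).indicator F (Fin.cons q.1 q.2) := by
    ext q; rw [Function.comp, hcons]
  rw [e] at hint2
  simp_rw [hcons]
  rw [Measure.volume_eq_prod] at hint2 ⊢
  rw [integral_prod_symm _ hint2]
  congr 1
  ext u
  by_cases hu : u ∈ corner n
  · rw [Set.indicator_of_mem hu, intervalIntegral.integral_of_le (by linarith [hu.2]),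
      ← integral_Icc_eq_integral_Ioc, ← integral_indicator measurableSet_Icc]
    congr 1
    ext r
    by_cases hr : r ∈ Set.Icc 0 (1 - ∑ i, u i)
    · rw [Set.indicator_of_mem hr, Set.indicator_of_mem (cons_mem_corner_iff.2 ⟨hu, hr⟩)]
    · rw [Set.indicator_of_notMem hr,
        Set.indicator_of_notMem fun h => hr (cons_mem_corner_iff.1 h).2]
  · rw [Set.indicator_of_notMem hu]
    refine (integral_congr_ae (Filter.Eventually.of_forall fun r => ?_)).trans
      (integral_zero _ _)
    exact Set.indicator_of_notMem (fun h => hu (cons_mem_corner_iff.1 h).1) _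

/-- The divided difference of `f` at the distinct nodes `x`, as the sum of the
`f (x i) / ∏_{j ≠ i} (x i - x j)`; the factor `j = i` is set to `1`. -/
noncomputable def divDiff (f : ℝ → ℝ) {n : ℕ} (x : Fin n → ℝ) : ℝ :=
  ∑ i, f (x i) * ∏ j, if j = i then 1 else (x i - x j)⁻¹

/-- The recurrence defining divided differences, for the explicit formula. -/
theorem divDiff_recurrence (f : ℝ → ℝ) {n : ℕ} {a b : ℝ} {y : Fin n → ℝ} (hab : a ≠ b)
    (ha : ∀ i, y i ≠ a) (hb : ∀ i, y i ≠ b) :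
    (divDiff f (Fin.cons b y : Fin (n + 1) → ℝ) - divDiff f (Fin.cons a y : Fin (n + 1) → ℝ)) /
      (b - a) = divDiff f (Fin.cons a (Fin.cons b y : Fin (n + 1) → ℝ) : Fin (n + 2) → ℝ) := by
  have hba : b - a ≠ 0 := sub_ne_zero.2 hab.symm
  have hab' : a - b ≠ 0 := sub_ne_zero.2 hab
  simp only [divDiff, Fin.sum_univ_succ, Fin.prod_univ_succ, Fin.cons_zero, Fin.cons_succ,
    Fin.succ_ne_zero, if_true, if_false, Fin.succ_inj, one_mul, (Fin.succ_ne_zero _).symm]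
  -- The terms of the common nodes combine by partial fractions.
  rw [div_eq_iff hba, add_mul, add_mul, Finset.sum_mul]
  have h3 : ∀ i, f (y i) * ((y i - a)⁻¹ * ((y i - b)⁻¹ *
      ∏ j, if j = i then 1 else (y i - y j)⁻¹)) * (b - a) =
      f (y i) * ((y i - b)⁻¹ * ∏ j, if j = i then 1 else (y i - y j)⁻¹) -
      f (y i) * ((y i - a)⁻¹ * ∏ j, if j = i then 1 else (y i - y j)⁻¹) := fun i => by
    have h1 : y i - a ≠ 0 := sub_ne_zero.2 (ha i)
    have h2 : y i - b ≠ 0 := sub_ne_zero.2 (hb i)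
    field_simp
    ring
  rw [Finset.sum_congr rfl fun i _ => h3 i, Finset.sum_sub_distrib]
  have e1 : ∀ A : ℝ, f a * ((a - b)⁻¹ * A) * (b - a) = -(f a * A) := fun A => by
    field_simp; ring
  have e2 : ∀ A : ℝ, f b * ((b - a)⁻¹ * A) * (b - a) = f b * A := fun A => by
    field_simp
  rw [e1, e2]
  ring

/-- The **Hermite–Genocchi formula**: the integral over a simplex of the `d`-th derivative of a
function of one linear coordinate is a divided difference. Here `g 0` is the `d`-th derivative of
`g d`. -/
theorem hermite_genocchi {d : ℕ} (g : ℕ → ℝ → ℝ) (hg : ∀ n x, HasDerivAt (g (n + 1)) (g n x) x)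
    (hg0 : Continuous (g 0)) (a : ℝ) (y : Fin d → ℝ) (ha : ∀ i, y i ≠ a)
    (hy : Function.Injective y) :
    ∫ t in corner d, g 0 (a + ∑ i, t i * (y i - a)) =
      divDiff (g d) (Fin.cons a y : Fin (d + 1) → ℝ) := by
  induction d generalizing g a with
  | zero =>
    have : corner 0 = Set.univ := by ext t; simp [corner]
    rw [this]
    simp [divDiff, Measure.volume_pi_eq_dirac (0 : Fin 0 → ℝ)]
  | succ d ih =>
    obtain ⟨b, y, rfl⟩ : ∃ (b : ℝ) (y' : Fin d → ℝ), y = Fin.cons b y' :=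
      ⟨y 0, Fin.tail y, (Fin.cons_self_tail y).symm⟩
    have hba : b ≠ a := by simpa using ha 0
    have hya : ∀ i, y i ≠ a := fun i => by simpa using ha i.succ
    have hyb : ∀ i, y i ≠ b := fun i h => by
      have := @hy i.succ 0 (by simpa using h)
      exact Fin.succ_ne_zero _ this
    have hy' : Function.Injective y := (Fin.cons_injective_iff.1 hy).2
    have hc1 : Continuous (g 1) := continuous_iff_continuousAt.2 fun x => (hg 0 x).continuousAt
    rw [integral_corner_succ (by fun_prop)]
    -- The integral over the first coordinate is computed from the antiderivative `g 1`.
    have inner : ∀ u : Fin d → ℝ,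
        ∫ r in (0 : ℝ)..(1 - ∑ i, u i), g 0 (a + ∑ i, (Fin.cons r u : Fin (d + 1) → ℝ) i *
          ((Fin.cons b y : Fin (d + 1) → ℝ) i - a)) =
        (g 1 (b + ∑ i, u i * (y i - b)) - g 1 (a + ∑ i, u i * (y i - a))) / (b - a) := by
      intro u
      have hba' : b - a ≠ 0 := sub_ne_zero.2 hba
      simp only [Fin.sum_univ_succ, Fin.cons_zero, Fin.cons_succ]
      rw [intervalIntegral.integral_eq_sub_of_hasDerivAt
        (f := fun r => g 1 (a + (r * (b - a) + ∑ i, u i * (y i - a))) / (b - a))]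
      · have e : a + ((1 - ∑ i, u i) * (b - a) + ∑ i, u i * (y i - a)) =
            b + ∑ i, u i * (y i - b) := by
          simp only [mul_sub, Finset.sum_sub_distrib, ← Finset.sum_mul]
          ring
        rw [← sub_div, e, zero_mul, zero_add]
      · intro r _
        have h1 : HasDerivAt (fun r : ℝ => a + (r * (b - a) + ∑ i, u i * (y i - a))) (b - a) r := by
          have := (((hasDerivAt_id r).mul_const (b - a)).add_const
            (∑ i, u i * (y i - a))).const_add a
          simpa using this
        have h2 := ((hg 0 _).comp r h1).div_const (b - a)
        rw [mul_div_cancel_right₀ _ hba'] at h2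
        exact h2
      · exact (by fun_prop : Continuous _).intervalIntegrable _ _
    simp_rw [inner]
    rw [integral_div, integral_sub]
    · rw [ih (fun n => g (n + 1)) (fun n x => hg (n + 1) x) hc1 b y hyb hy',
        ih (fun n => g (n + 1)) (fun n x => hg (n + 1) x) hc1 a y hya hy']
      exact divDiff_recurrence _ hba.symm hya hyb
    · exact (by fun_prop : Continuous _).continuousOn.integrableOn_compact (isCompact_corner _)
    · exact (by fun_prop : Continuous _).continuousOn.integrableOn_compact (isCompact_corner _)

/-- The divided powers `x ^ (n + k - d) / (n + k - d)!`, set to zero as long as `n + k < d`: each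
is the derivative of the next one. -/
noncomputable def dividedPow (d k n : ℕ) (x : ℝ) : ℝ :=
  if n + k < d then 0 else x ^ (n + k - d) / ((n + k - d).factorial : ℝ)

theorem hasDerivAt_dividedPow (d k n : ℕ) (x : ℝ) :
    HasDerivAt (dividedPow d k (n + 1)) (dividedPow d k n x) x := by
  unfold dividedPow
  by_cases h1 : n + 1 + k < d
  · simp only [h1, if_true, show n + k < d by omega]
    exact hasDerivAt_const _ _
  · by_cases h2 : n + k < d
    · simp only [h2, h1, if_true, if_false, show n + 1 + k - d = 0 by omega, pow_zero]
      exact hasDerivAt_const _ _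
    · simp only [h2, h1, if_false, show n + 1 + k - d = (n + k - d) + 1 by omega]
      have h := (hasDerivAt_pow ((n + k - d) + 1) x).div_const (((n + k - d) + 1).factorial : ℝ)
      refine h.congr_deriv ?_
      have h3 : ((n + k - d).factorial : ℝ) ≠ 0 := by positivity
      rw [Nat.factorial_succ, Nat.add_sub_cancel]
      push_cast
      field_simp

end Corner

/-! ### Linear coordinates and exponential integrals over simplicial cones -/

section Frames

open MeasureTheory

variable {d : ℕ}

/-- The parametrisation `t ↦ v + ∑ t_i w_i` of the space by coordinates. -/
noncomputable def frameMap (v : EuclideanSpace ℝ (Fin d)) (w : Fin d → EuclideanSpace ℝ (Fin d))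
    (t : Fin d → ℝ) : EuclideanSpace ℝ (Fin d) :=
  v + ∑ i, t i • w i

/-- The absolute value of the determinant of the vectors `w_1, …, w_d`. -/
noncomputable def absDet (w : Fin d → EuclideanSpace ℝ (Fin d)) : ℝ :=
  |(Matrix.of fun i k => w k i).det|

theorem inner_frameMap (v z : EuclideanSpace ℝ (Fin d)) (w : Fin d → EuclideanSpace ℝ (Fin d))
    (t : Fin d → ℝ) : ⟪frameMap v w t, z⟫ = ⟪v, z⟫ + ∑ i, t i * ⟪w i, z⟫ := by
  simp [frameMap, inner_add_left, sum_inner, real_inner_smul_left]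

theorem frameMap_eq_toLp (v : EuclideanSpace ℝ (Fin d)) (w : Fin d → EuclideanSpace ℝ (Fin d))
    (t : Fin d → ℝ) :
    frameMap v w t = WithLp.toLp 2 (v.ofLp + (Matrix.of fun i k => w k i).mulVec t) := by
  ext j
  simp [frameMap, Matrix.mulVec, dotProduct, mul_comm]

theorem frameMap_image_eq (v : EuclideanSpace ℝ (Fin d)) (w : Fin d → EuclideanSpace ℝ (Fin d))
    (S : Set (Fin d → ℝ)) : frameMap v w '' S = WithLp.toLp 2 ''
      ((fun t => v.ofLp + (Matrix.of fun i k => w k i).mulVec t) '' S) := by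
  rw [Set.image_image]
  exact Set.image_congr fun t _ => frameMap_eq_toLp v w t

theorem measurableEmbedding_toLp :
    MeasurableEmbedding (WithLp.toLp 2 : (Fin d → ℝ) → EuclideanSpace ℝ (Fin d)) :=
  (MeasurableEquiv.toLp 2 (Fin d → ℝ)).measurableEmbedding

theorem hasFDerivAt_coords (v : EuclideanSpace ℝ (Fin d)) (M : Matrix (Fin d) (Fin d) ℝ)
    (t : Fin d → ℝ) : HasFDerivAt (fun t => v.ofLp + M.mulVec t)
      (LinearMap.toContinuousLinearMap (Matrix.toLin' M)) t :=
  ((LinearMap.toContinuousLinearMap (Matrix.toLin' M)).hasFDerivAt).const_add v.ofLp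

theorem injective_coords (v : EuclideanSpace ℝ (Fin d)) {M : Matrix (Fin d) (Fin d) ℝ}
    (hM : M.det ≠ 0) : Function.Injective fun t => v.ofLp + M.mulVec t := by
  intro t t' h
  exact Matrix.mulVec_injective_of_isUnit ((Matrix.isUnit_iff_isUnit_det M).2 hM.isUnit)
    (add_left_cancel h)

theorem integral_frameMap_image (v : EuclideanSpace ℝ (Fin d))
    {w : Fin d → EuclideanSpace ℝ (Fin d)} (hw : absDet w ≠ 0) {S : Set (Fin d → ℝ)}
    (hS : MeasurableSet S) (f : EuclideanSpace ℝ (Fin d) → ℝ) :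
    ∫ x in frameMap v w '' S, f x = absDet w * ∫ t in S, f (frameMap v w t) := by
  have hM := abs_ne_zero.1 hw
  rw [frameMap_image_eq, (PiLp.volume_preserving_toLp (Fin d)).setIntegral_image_emb
    measurableEmbedding_toLp, integral_image_eq_integral_abs_det_fderiv_smul volume hS
    (fun t _ => (hasFDerivAt_coords v _ t).hasFDerivWithinAt) (injective_coords v hM).injOn,
    ← integral_const_mul]
  congr 1
  ext t
  rw [← frameMap_eq_toLp, smul_eq_mul, absDet, LinearMap.det_toContinuousLinearMap,
    LinearMap.det_toLin']

theorem integrableOn_frameMap_image (v : EuclideanSpace ℝ (Fin d))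
    {w : Fin d → EuclideanSpace ℝ (Fin d)} (hw : absDet w ≠ 0) {S : Set (Fin d → ℝ)}
    (hS : MeasurableSet S) {f : EuclideanSpace ℝ (Fin d) → ℝ}
    (hf : IntegrableOn (fun t => f (frameMap v w t)) S) :
    IntegrableOn f (frameMap v w '' S) := by
  have hM := abs_ne_zero.1 hw
  rw [frameMap_image_eq, (PiLp.volume_preserving_toLp (Fin d)).integrableOn_image
    measurableEmbedding_toLp, integrableOn_image_iff_integrableOn_abs_det_fderiv_smul volume hS
    (fun t _ => (hasFDerivAt_coords v _ t).hasFDerivWithinAt) (injective_coords v hM).injOn]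
  simp only [Function.comp_def, ← frameMap_eq_toLp, smul_eq_mul]
  simp only [LinearMap.det_toContinuousLinearMap]
  exact hf.const_mul _

theorem measurableSet_frameMap_image (v : EuclideanSpace ℝ (Fin d))
    {w : Fin d → EuclideanSpace ℝ (Fin d)} (hw : absDet w ≠ 0) {S : Set (Fin d → ℝ)}
    (hS : MeasurableSet S) : MeasurableSet (frameMap v w '' S) := by
  have hM := abs_ne_zero.1 hw
  rw [frameMap_image_eq]
  refine measurableEmbedding_toLp.measurableSet_image.2 (hS.image_of_continuousOn_injOn ?_
    (injective_coords v hM).injOn)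
  exact fun t _ => (hasFDerivAt_coords v _ t).continuousAt.continuousWithinAt

theorem volume_real_frameMap_image (v : EuclideanSpace ℝ (Fin d))
    {w : Fin d → EuclideanSpace ℝ (Fin d)} (hw : absDet w ≠ 0) {S : Set (Fin d → ℝ)}
    (hS : MeasurableSet S) :
    volume.real (frameMap v w '' S) = absDet w * volume.real S := by
  have := integral_frameMap_image v hw hS (fun _ => 1)
  simpa using this

theorem absDet_ne_zero_of_linearIndependent {w : Fin d → EuclideanSpace ℝ (Fin d)}
    (hw : LinearIndependent ℝ w) : absDet w ≠ 0 := by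
  have h1 : LinearIndependent ℝ (Matrix.of fun i k => w k i : Matrix (Fin d) (Fin d) ℝ).col :=
    hw.map' (WithLp.linearEquiv 2 ℝ (Fin d → ℝ)).toLinearMap (LinearEquiv.ker _)
  rw [Matrix.linearIndependent_cols_iff_isUnit, Matrix.isUnit_iff_isUnit_det] at h1
  exact abs_ne_zero.2 h1.ne_zero

/-- The closed positive orthant. -/
def orthant (d : ℕ) : Set (Fin d → ℝ) := {t | ∀ i, 0 ≤ t i}

theorem orthant_eq_pi (d : ℕ) : orthant d = Set.univ.pi fun _ => Set.Ici (0 : ℝ) := by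
  ext; simp [orthant, Pi.le_def]

theorem measurableSet_orthant (d : ℕ) : MeasurableSet (orthant d) := by
  rw [orthant_eq_pi]
  exact MeasurableSet.univ_pi fun _ => measurableSet_Ici

theorem indicator_orthant_exp (a t : Fin d → ℝ) :
    (orthant d).indicator (fun t => Real.exp (∑ i, t i * a i)) t =
      ∏ i, (Set.Ici (0 : ℝ)).indicator (fun r => Real.exp (a i * r)) (t i) := by
  by_cases ht : t ∈ orthant d
  · rw [Set.indicator_of_mem ht, Real.exp_sum]
    exact Finset.prod_congr rfl fun i _ => by
      rw [Set.indicator_of_mem (show t i ∈ Set.Ici (0 : ℝ) from ht i), mul_comm]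
  · rw [Set.indicator_of_notMem ht]
    simp only [orthant, Set.mem_ofPred_eq, not_forall] at ht
    obtain ⟨i, hi⟩ := ht
    exact (Finset.prod_eq_zero (Finset.mem_univ i) (Set.indicator_of_notMem hi _)).symm

theorem integrableOn_orthant_exp {a : Fin d → ℝ} (ha : ∀ i, a i < 0) :
    IntegrableOn (fun t => Real.exp (∑ i, t i * a i)) (orthant d) := by
  rw [← integrable_indicator_iff (measurableSet_orthant d)]
  simp_rw [funext (indicator_orthant_exp a)]
  refine Integrable.fintype_prod (f := fun i =>
    (Set.Ici (0 : ℝ)).indicator fun r => Real.exp (a i * r)) fun i => ?_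
  rw [integrable_indicator_iff measurableSet_Ici]
  rw [integrableOn_Ici_iff_integrableOn_Ioi]
  exact integrableOn_exp_mul_Ioi (ha i) 0

theorem integral_orthant_exp {a : Fin d → ℝ} (ha : ∀ i, a i < 0) :
    ∫ t in orthant d, Real.exp (∑ i, t i * a i) = ∏ i, (-a i)⁻¹ := by
  rw [← integral_indicator (measurableSet_orthant d)]
  simp_rw [indicator_orthant_exp]
  rw [integral_fintype_prod_volume_eq_prod
    (fun i => (Set.Ici (0 : ℝ)).indicator fun r => Real.exp (a i * r))]
  refine Finset.prod_congr rfl fun i _ => ?_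
  rw [integral_indicator measurableSet_Ici, integral_Ici_eq_integral_Ioi,
    integral_exp_mul_Ioi (ha i)]
  simp [neg_div, inv_neg]

theorem integrableOn_cone_exp {w : Fin d → EuclideanSpace ℝ (Fin d)} (hw : absDet w ≠ 0)
    {z : EuclideanSpace ℝ (Fin d)} (hz : ∀ i, ⟪w i, z⟫ < 0) :
    IntegrableOn (fun y => Real.exp ⟪y, z⟫) (frameMap 0 w '' orthant d) := by
  refine integrableOn_frameMap_image 0 hw (measurableSet_orthant d) ?_
  simp_rw [inner_frameMap, inner_zero_left, zero_add]
  exact integrableOn_orthant_exp hz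

theorem integral_cone_exp {w : Fin d → EuclideanSpace ℝ (Fin d)} (hw : absDet w ≠ 0)
    {z : EuclideanSpace ℝ (Fin d)} (hz : ∀ i, ⟪w i, z⟫ < 0) :
    ∫ y in frameMap 0 w '' orthant d, Real.exp ⟪y, z⟫ = absDet w * ∏ i, (-⟪w i, z⟫)⁻¹ := by
  rw [integral_frameMap_image 0 hw (measurableSet_orthant d)]
  simp_rw [inner_frameMap, inner_zero_left, zero_add]
  rw [integral_orthant_exp hz]

theorem volume_real_corner_ne_zero (d : ℕ) : volume.real (corner d) ≠ 0 := by
  have hlt : volume (corner d) < ⊤ := (isCompact_corner d).measure_lt_top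
  have hpos : 0 < volume (corner d) := by
    have hsub : Set.univ.pi (fun _ : Fin d => Set.Ioo (0 : ℝ) (1 / (d + 1))) ⊆ corner d := by
      intro t ht
      simp only [Set.mem_pi, Set.mem_univ, forall_const] at ht
      refine ⟨fun i => (ht i).1.le, (Finset.sum_le_card_nsmul _ _ _ fun i _ => (ht i).2.le).trans ?_⟩
      rw [Finset.card_univ, Fintype.card_fin, nsmul_eq_mul, mul_one_div,
        div_le_one (by positivity)]
      linarith
    refine lt_of_lt_of_le ?_ (measure_mono hsub)
    rw [Real.volume_pi_Ioo]
    refine pos_iff_ne_zero.2 (Finset.prod_ne_zero_iff.2 fun i _ => ?_)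
    have : (0 : ℝ) < 1 / (d + 1) := by positivity
    simpa using this
  exact (ENNReal.toReal_pos hpos.ne' hlt.ne).ne'

end Frames

/-! ### Cones of feasible directions -/

section TangentCone

variable {d : ℕ}

/-- The cone of feasible directions of `Q` at `v`. -/
def feasibleCone (Q : Set (EuclideanSpace ℝ (Fin d))) (v : EuclideanSpace ℝ (Fin d)) :
    Set (EuclideanSpace ℝ (Fin d)) :=
  {y | ∃ ε : ℝ, 0 < ε ∧ v + ε • y ∈ Q}

theorem add_smul_mem_of_convex {Q : Set (EuclideanSpace ℝ (Fin d))} (hQ : Convex ℝ Q)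
    {v y : EuclideanSpace ℝ (Fin d)} (hv : v ∈ Q) {ε r : ℝ} (hε : 0 < ε) (hr : 0 ≤ r)
    (hrε : r ≤ ε) (h : v + ε • y ∈ Q) : v + r • y ∈ Q := by
  have := hQ.add_smul_mem hv h (t := r / ε)
    ⟨by positivity, (div_le_one hε).2 hrε⟩
  rwa [smul_smul, div_mul_cancel₀ _ hε.ne'] at this

theorem frameMap_mem_of_mem_corner {Q : Set (EuclideanSpace ℝ (Fin d))} (hQ : Convex ℝ Q)
    {v : EuclideanSpace ℝ (Fin d)} {w : Fin d → EuclideanSpace ℝ (Fin d)}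
    (hv : v ∈ Q) (hw : ∀ i, v + w i ∈ Q) {t : Fin d → ℝ} (ht : t ∈ corner d) :
    frameMap v w t ∈ Q := by
  have h := hQ.sum_mem (t := Finset.univ) (w := (Fin.cons (1 - ∑ i, t i) t : Fin (d + 1) → ℝ))
    (z := (Fin.cons v fun i => v + w i : Fin (d + 1) → EuclideanSpace ℝ (Fin d)))
    (fun i _ => Fin.cases (by simpa using ht.2) (fun i => by simpa using ht.1 i) i)
    (by simp [Fin.sum_univ_succ])
    (fun i _ => Fin.cases (by simpa using hv) (fun i => by simpa using hw i) i)
  convert h using 1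
  simp [Fin.sum_univ_succ, frameMap, Finset.sum_add_distrib, ← Finset.sum_smul, sub_smul]
  abel

/-- If a convex set contains `v` and the points `v + w_i`, and is contained in the cone spanned by
the `w_i` with apex `v`, then this cone is its cone of feasible directions at `v`. -/
theorem feasibleCone_eq_of_frame {Q : Set (EuclideanSpace ℝ (Fin d))} (hQ : Convex ℝ Q)
    {v : EuclideanSpace ℝ (Fin d)} {w : Fin d → EuclideanSpace ℝ (Fin d)}
    (hv : v ∈ Q) (hw : ∀ i, v + w i ∈ Q) (hsub : Q ⊆ frameMap v w '' orthant d) :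
    feasibleCone Q v = frameMap 0 w '' orthant d := by
  ext y
  constructor
  · rintro ⟨ε, hε, h⟩
    obtain ⟨t, ht, hty⟩ := hsub h
    refine ⟨fun i => ε⁻¹ * t i, fun i => mul_nonneg (by positivity) (ht i), ?_⟩
    have h1 : ∑ i, t i • w i = ε • y := add_left_cancel hty
    simp only [frameMap, zero_add, mul_smul, ← Finset.smul_sum, h1]
    rw [inv_smul_smul₀ hε.ne']
  · rintro ⟨t, ht, rfl⟩
    have hS : 0 ≤ ∑ i, t i := Finset.sum_nonneg fun i _ => ht i
    refine ⟨(1 + ∑ i, t i)⁻¹, by positivity, ?_⟩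
    have : v + (1 + ∑ i, t i)⁻¹ • frameMap 0 w t =
        frameMap v w (fun i => (1 + ∑ i, t i)⁻¹ * t i) := by
      simp [frameMap, Finset.smul_sum, mul_smul]
    rw [this]
    refine frameMap_mem_of_mem_corner hQ hv hw ⟨fun i => mul_nonneg (by positivity) (ht i), ?_⟩
    rw [← Finset.mul_sum, inv_mul_le_one₀ (by positivity)]
    linarith

theorem eventually_mem_iff_mem_feasibleCone {Q : Set (EuclideanSpace ℝ (Fin d))}
    (hQ : Convex ℝ Q) {v : EuclideanSpace ℝ (Fin d)} (hv : v ∈ Q)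
    (y : EuclideanSpace ℝ (Fin d)) :
    ∀ᶠ n : ℕ in Filter.atTop, v + (1 / ((n : ℝ) + 1)) • y ∈ Q ↔ y ∈ feasibleCone Q v := by
  by_cases hy : y ∈ feasibleCone Q v
  · obtain ⟨ε, hε, h⟩ := hy
    filter_upwards [tendsto_one_div_add_atTop_nhds_zero_nat.eventually (ge_mem_nhds hε)] with n hn
    exact iff_of_true (add_smul_mem_of_convex hQ hv hε (by positivity) hn h) ⟨ε, hε, h⟩
  · exact Filter.Eventually.of_forall fun n =>
      iff_of_false (fun h => hy ⟨_, by positivity, h⟩) hy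

theorem eventually_notMem_of_notMem {Q : Set (EuclideanSpace ℝ (Fin d))}
    (hQ : IsClosed Q) {v : EuclideanSpace ℝ (Fin d)} (hv : v ∉ Q)
    (y : EuclideanSpace ℝ (Fin d)) :
    ∀ᶠ n : ℕ in Filter.atTop, v + (1 / ((n : ℝ) + 1)) • y ∉ Q := by
  have h : Filter.Tendsto (fun n : ℕ => v + (1 / ((n : ℝ) + 1)) • y) Filter.atTop (nhds v) := by
    have := (tendsto_one_div_add_atTop_nhds_zero_nat (𝕜 := ℝ)).smul_const y |>.const_add v
    simpa using this
  exact h.eventually (hQ.isOpen_compl.mem_nhds hv)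

end TangentCone

/-! ### The edges at a vertex span the cone of feasible directions -/

section Edges

variable {d : ℕ} {P : Set (EuclideanSpace ℝ (Fin d))} {v : EuclideanSpace ℝ (Fin d)}

theorem smul_mem_hull {B : Set (EuclideanSpace ℝ (Fin d))} {x : EuclideanSpace ℝ (Fin d)} {r : ℝ}
    (hr : 0 ≤ r) (hx : x ∈ PointedCone.hull ℝ B) : r • x ∈ PointedCone.hull ℝ B :=
  Submodule.smul_mem (PointedCone.hull ℝ B) (⟨r, hr⟩ : {c : ℝ // 0 ≤ c}) hx

theorem hull_subset_feasibleCone (hP : Convex ℝ P) (hv : v ∈ P)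
    {B : Set (EuclideanSpace ℝ (Fin d))} (hB : ∀ b ∈ B, v + b ∈ P)
    {x : EuclideanSpace ℝ (Fin d)} (hx : x ∈ PointedCone.hull ℝ B) : x ∈ feasibleCone P v := by
  induction hx using Submodule.span_induction with
  | mem x hx => exact ⟨1, one_pos, by simpa using hB x hx⟩
  | zero => exact ⟨1, one_pos, by simpa using hv⟩
  | add x y _ _ hx hy =>
    obtain ⟨a, ha, hxa⟩ := hx
    obtain ⟨b, hb, hyb⟩ := hy
    have hm : 0 < min a b := lt_min ha hb
    have h1 := add_smul_mem_of_convex hP hv ha hm.le (min_le_left a b) hxa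
    have h2 := add_smul_mem_of_convex hP hv hb hm.le (min_le_right a b) hyb
    refine ⟨min a b / 2, by positivity, ?_⟩
    have h3 := hP h1 h2 (a := 1 / 2) (b := 1 / 2) (by norm_num) (by norm_num) (by norm_num)
    convert h3 using 1
    module
  | smul c x _ hx =>
    obtain ⟨a, ha, hxa⟩ := hx
    have hc : (0 : ℝ) ≤ c := c.2
    refine ⟨a / (c + 1), by positivity, ?_⟩
    have h1 : v + (a / ((c : ℝ) + 1)) • c • x = v + (a * (c / ((c : ℝ) + 1))) • x := by
      have : c • x = (c : ℝ) • x := rfl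
      rw [this, smul_smul]
      congr 2
      ring
    rw [h1]
    refine add_smul_mem_of_convex hP hv ha (by positivity) ?_ hxa
    exact mul_le_of_le_one_right ha.le ((div_le_one (by positivity)).2 (by linarith))

/-- The cone of feasible directions at a vertex contains no line. -/
theorem eq_zero_of_mem_feasibleCone (hP : Convex ℝ P) (hv : v ∈ P.extremePoints ℝ)
    {x : EuclideanSpace ℝ (Fin d)} (hx : x ∈ feasibleCone P v) (hx' : -x ∈ feasibleCone P v) :
    x = 0 := by
  obtain ⟨a, ha, hxa⟩ := hx
  obtain ⟨b, hb, hxb⟩ := hx'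
  have hm : 0 < min a b := lt_min ha hb
  have h1 := add_smul_mem_of_convex hP hv.1 ha hm.le (min_le_left a b) hxa
  have h2 := add_smul_mem_of_convex hP hv.1 hb hm.le (min_le_right a b) hxb
  have h3 := hv.2 h1 h2 ⟨1 / 2, 1 / 2, by norm_num, by norm_num, by norm_num, by module⟩
  have h4 : min a b • x = 0 := by simpa using h3
  exact (smul_eq_zero.1 h4).resolve_left hm.ne'

/-- The last point of a compact set on a ray that starts in the set. -/
theorem exists_last_mem (hP : IsCompact P) {b : EuclideanSpace ℝ (Fin d)} (hb : b ≠ 0)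
    (hvb : v + b ∈ P) :
    ∃ r : ℝ, 1 ≤ r ∧ v + r • b ∈ P ∧ ∀ r', v + r' • b ∈ P → r' ≤ r := by
  obtain ⟨R, hR⟩ := hP.isBounded.exists_norm_le
  let L := Set.Icc (1 : ℝ) ((R + ‖v‖) / ‖b‖) ∩ {r | v + r • b ∈ P}
  have hb' : 0 < ‖b‖ := norm_pos_iff.2 hb
  have hbd : ∀ r : ℝ, v + r • b ∈ P → r ≤ (R + ‖v‖) / ‖b‖ := fun r hr => by
    rw [le_div_iff₀ hb']
    have h1 := hR _ hr
    have h2 : ‖r • b‖ ≤ ‖v + r • b‖ + ‖v‖ := by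
      simpa using norm_sub_le (v + r • b) v
    rw [norm_smul, Real.norm_eq_abs] at h2
    nlinarith [le_abs_self r]
  have hLc : IsCompact L := isCompact_Icc.inter_right
    (hP.isClosed.preimage (by fun_prop : Continuous fun r : ℝ => v + r • b))
  have h1 : (1 : ℝ) ∈ L := by
    have : v + (1 : ℝ) • b ∈ P := by simpa using hvb
    exact ⟨⟨le_rfl, hbd 1 this⟩, this⟩
  obtain ⟨r, hr, hmax⟩ := hLc.exists_isGreatest ⟨1, h1⟩
  refine ⟨r, hr.1.1, hr.2, fun r' hr' => ?_⟩
  by_cases h : 1 ≤ r'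
  · exact hmax ⟨⟨h, hbd r' hr'⟩, hr'⟩
  · exact (not_le.1 h).le.trans hr.1.1

/-- An extreme ray of the cone of feasible directions at a vertex `v` carries an edge. -/
theorem exists_neighbor_of_extreme_ray (hP : IsCompact P) (hc : Convex ℝ P)
    (hv : v ∈ P) {b : EuclideanSpace ℝ (Fin d)} (hb : b ≠ 0) (hvb : v + b ∈ P)
    {B : Set (EuclideanSpace ℝ (Fin d))} (hB : ∀ x ∈ P, x - v ∈ PointedCone.hull ℝ B)
    (hray : ∀ p ∈ PointedCone.hull ℝ B, ∀ q ∈ PointedCone.hull ℝ B, ∀ r : ℝ, p + q = r • b →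
      ∃ α : ℝ, 0 ≤ α ∧ p = α • b) :
    ∃ r : ℝ, 0 < r ∧ v + r • b ∈ neighbors P v := by
  obtain ⟨r, hr1, hrP, hmax⟩ := exists_last_mem hP hb hvb
  have hr0 : 0 < r := by linarith
  -- A point of `P` on one side of a point of the ray is itself on the ray.
  have key : ∀ x₁ ∈ P, ∀ x₂ ∈ P, ∀ a c r' : ℝ, 0 < a → 0 < c → a + c = 1 →
      a • x₁ + c • x₂ = v + r' • b → ∃ ρ : ℝ, 0 ≤ ρ ∧ ρ ≤ r ∧ x₁ = v + ρ • b := by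
    intro x₁ h1 x₂ h2 a c r' ha hc' hac he
    obtain ⟨α, hα, h⟩ := hray _ (smul_mem_hull ha.le (hB x₁ h1)) _
      (smul_mem_hull hc'.le (hB x₂ h2)) r' (by
        have : v = a • v + c • v := by rw [← add_smul, hac, one_smul]
        rw [smul_sub, smul_sub, eq_sub_of_add_eq' he.symm]
        nth_rewrite 3 [this]
        abel)
    have hx : x₁ = v + (α / a) • b := by
      have : x₁ - v = a⁻¹ • α • b := by rw [← h, inv_smul_smul₀ ha.ne']
      rw [eq_add_of_sub_eq' this, smul_smul]
      congr 2
      ring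
    exact ⟨α / a, by positivity, hmax _ (hx ▸ h1), hx⟩
  refine ⟨r, hr0, ⟨hrP, ?_⟩, ?_, ?_⟩
  · rintro x₁ h1 x₂ h2 ⟨a, c, ha, hc', hac, he⟩
    obtain ⟨ρ₁, -, hρ₁, rfl⟩ := key x₁ h1 x₂ h2 a c r ha hc' hac he
    obtain ⟨ρ₂, -, hρ₂, rfl⟩ := key x₂ h2 _ h1 c a r hc' ha (by linarith) (by rw [add_comm, he])
    have h3 : (a * ρ₁ + c * ρ₂ - r) • b = 0 := by
      have : (a * ρ₁ + c * ρ₂ - r) • b =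
          (a • (v + ρ₁ • b) + c • (v + ρ₂ • b)) - (v + r • b) + (1 - (a + c)) • v := by module
      rw [this, he, hac]
      simp
    have h4 := (smul_eq_zero.1 h3).resolve_right hb
    have h5 : ρ₁ = r := by
      refine le_antisymm hρ₁ ?_
      by_contra hlt
      push Not at hlt
      nlinarith
    rw [h5]
  · simpa using ⟨hr0.ne', hb⟩
  · refine ⟨(hc.segment_subset hv hrP), ?_⟩
    rintro x₁ h1 x₂ h2 x hx ⟨a, c, ha, hc', hac, he⟩
    rw [segment_eq_image'] at hx ⊢
    obtain ⟨θ, -, hθ⟩ := hx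
    obtain ⟨ρ, hρ0, hρr, rfl⟩ := key x₁ h1 x₂ h2 a c (θ * r) ha hc' hac (by
      rw [he, ← hθ]
      simp only [add_sub_cancel_left, smul_smul])
    refine ⟨ρ / r, ⟨by positivity, (div_le_one hr0).2 hρr⟩, ?_⟩
    simp only [add_sub_cancel_left, smul_smul]
    rw [div_mul_cancel₀ _ hr0.ne']

/-- A member of a minimal system of generators of a pointed cone spans an extreme ray. -/
theorem exists_smul_of_add_eq_smul {B : Set (EuclideanSpace ℝ (Fin d))}
    {b : EuclideanSpace ℝ (Fin d)} (hbB : b ∈ B) (hmin : b ∉ PointedCone.hull ℝ (B \ {b}))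
    (hpt : ∀ x ∈ PointedCone.hull ℝ B, -x ∈ PointedCone.hull ℝ B → x = 0)
    {p q : EuclideanSpace ℝ (Fin d)} (hp : p ∈ PointedCone.hull ℝ B)
    (hq : q ∈ PointedCone.hull ℝ B) {r : ℝ} (h : p + q = r • b) :
    ∃ α : ℝ, 0 ≤ α ∧ p = α • b := by
  have hins : B = insert b (B \ {b}) := by
    rw [Set.insert_sdiff_singleton, Set.insert_eq_of_mem hbB]
  have hdec : ∀ x ∈ PointedCone.hull ℝ B, ∃ α : ℝ, 0 ≤ α ∧
      ∃ y ∈ PointedCone.hull ℝ (B \ {b}), x = α • b + y := by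
    intro x hx
    rw [hins, PointedCone.hull, Submodule.mem_span_insert] at hx
    obtain ⟨α, y, hy, rfl⟩ := hx
    exact ⟨α, α.2, y, hy, rfl⟩
  have hmono : PointedCone.hull ℝ (B \ {b}) ≤ PointedCone.hull ℝ B :=
    Submodule.span_mono Set.sdiff_subset
  obtain ⟨α, hα, p', hp', rfl⟩ := hdec p hp
  obtain ⟨β, hβ, q', hq', rfl⟩ := hdec q hq
  have h1 : p' + q' = (r - α - β) • b := by
    have : p' + q' = (α • b + p' + (β • b + q')) - (α + β) • b := by module
    rw [this, h]
    module
  have hle : r - α - β ≤ 0 := by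
    by_contra hlt
    push Not at hlt
    refine hmin ?_
    have := smul_mem_hull (inv_nonneg.2 hlt.le) (Submodule.add_mem _ hp' hq')
    rwa [h1, inv_smul_smul₀ hlt.ne'] at this
  have h2 : p' = 0 := by
    refine hpt p' (hmono hp') ?_
    have : -p' = q' + (-(r - α - β)) • b := by
      rw [neg_smul, ← h1]
      abel
    rw [this]
    exact Submodule.add_mem _ (hmono hq')
      (smul_mem_hull (by linarith) (Submodule.subset_span hbB))
  exact ⟨α, hα, by rw [h2, add_zero]⟩

theorem exists_minimal_generators (A : Finset (EuclideanSpace ℝ (Fin d))) :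
    ∃ B ⊆ A, PointedCone.hull ℝ (B : Set (EuclideanSpace ℝ (Fin d))) =
        PointedCone.hull ℝ (A : Set (EuclideanSpace ℝ (Fin d))) ∧
      ∀ b ∈ B, b ∉ PointedCone.hull ℝ ((B : Set (EuclideanSpace ℝ (Fin d))) \ {b}) := by
  classical
  let F := A.powerset.filter fun B : Finset (EuclideanSpace ℝ (Fin d)) => PointedCone.hull ℝ (B : Set (EuclideanSpace ℝ (Fin d))) =
        PointedCone.hull ℝ (A : Set (EuclideanSpace ℝ (Fin d)))
  obtain ⟨B, hB, hmin⟩ := F.exists_min_image Finset.card ⟨A, by simp [F]⟩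
  simp only [F, Finset.mem_filter, Finset.mem_powerset] at hB hmin
  refine ⟨B, hB.1, hB.2, fun b hb hmem => ?_⟩
  have h1 : PointedCone.hull ℝ ((B.erase b : Finset _) : Set (EuclideanSpace ℝ (Fin d))) =
      PointedCone.hull ℝ (B : Set (EuclideanSpace ℝ (Fin d))) := by
    have hins : (B : Set (EuclideanSpace ℝ (Fin d))) = insert b ((B : Set _) \ {b}) := by
      rw [Set.insert_sdiff_singleton, Set.insert_eq_of_mem (Finset.mem_coe.2 hb)]
    rw [Finset.coe_erase]
    conv_rhs => rw [hins]
    exact (Submodule.span_insert_eq_span hmem).symm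
  have h2 := hmin (B.erase b) ⟨(Finset.erase_subset _ _).trans hB.1, h1.trans hB.2⟩
  have h3 := Finset.card_erase_lt_of_mem hb
  omega

/-- A polytope is contained in the cone spanned by its edges at a vertex. -/
theorem subset_cone_of_edges {s : Finset (EuclideanSpace ℝ (Fin d))}
    (hP : P = convexHull ℝ (s : Set (EuclideanSpace ℝ (Fin d)))) (hv : v ∈ P.extremePoints ℝ)
    {w : Fin d → EuclideanSpace ℝ (Fin d)}
    (hw : Set.range w = (fun u => u - v) '' neighbors P v) :
    P ⊆ frameMap v w '' orthant d := by
  classical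
  have hc : Convex ℝ P := hP ▸ convex_convexHull ℝ _
  have hcpt : IsCompact P := hP ▸ s.finite_toSet.isCompact_convexHull (𝕜 := ℝ)
  have hsP : ∀ u ∈ s, u ∈ P := fun u hu => hP ▸ subset_convexHull ℝ _ hu
  let A := (s.erase v).image fun u => u - v
  obtain ⟨B, hBA, hBhull, hBmin⟩ := exists_minimal_generators A
  have hB : ∀ b ∈ B, b ≠ 0 ∧ v + b ∈ P := fun b hb => by
    obtain ⟨u, hu, rfl⟩ := Finset.mem_image.1 (hBA hb)
    exact ⟨sub_ne_zero.2 (Finset.ne_of_mem_erase hu), by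
      rw [add_sub_cancel]; exact hsP u (Finset.mem_of_mem_erase hu)⟩
  have hPB : ∀ x ∈ P, x - v ∈ PointedCone.hull ℝ (B : Set (EuclideanSpace ℝ (Fin d))) := by
    intro x hx
    rw [hBhull]
    rw [hP, Finset.mem_convexHull'] at hx
    obtain ⟨c, hc0, hc1, rfl⟩ := hx
    have : ∑ u ∈ s, c u • u - v = ∑ u ∈ s, c u • (u - v) := by
      simp [smul_sub, Finset.sum_sub_distrib, ← Finset.sum_smul, hc1]
    rw [this]
    refine Submodule.sum_mem _ fun u hu => smul_mem_hull (hc0 u hu) ?_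
    by_cases huv : u = v
    · rw [huv, sub_self]; exact Submodule.zero_mem _
    · exact Submodule.subset_span (Finset.mem_coe.2 (Finset.mem_image.2
        ⟨u, Finset.mem_erase.2 ⟨huv, hu⟩, rfl⟩))
  have hpt : ∀ x ∈ PointedCone.hull ℝ (B : Set (EuclideanSpace ℝ (Fin d))),
      -x ∈ PointedCone.hull ℝ (B : Set (EuclideanSpace ℝ (Fin d))) → x = 0 := fun x hx hx' =>
    eq_zero_of_mem_feasibleCone hc hv
      (hull_subset_feasibleCone hc hv.1 (fun b hb => (hB b hb).2) hx)
      (hull_subset_feasibleCone hc hv.1 (fun b hb => (hB b hb).2) hx')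
  -- Each minimal generator lies on an edge.
  have hle : PointedCone.hull ℝ (B : Set (EuclideanSpace ℝ (Fin d))) ≤
      PointedCone.hull ℝ (Set.range w) := by
    refine Submodule.span_le.2 fun b hb => ?_
    obtain ⟨r, hr, hn⟩ := exists_neighbor_of_extreme_ray hcpt hc hv.1 (hB b hb).1 (hB b hb).2 hPB
      fun p hp q hq r h => exists_smul_of_add_eq_smul hb (hBmin b hb) hpt hp hq h
    have hrw : r • b ∈ Set.range w := by
      rw [hw]; exact ⟨_, hn, add_sub_cancel_left _ _⟩
    have := smul_mem_hull (inv_nonneg.2 hr.le) (Submodule.subset_span hrw)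
    rwa [inv_smul_smul₀ hr.ne'] at this
  intro x hx
  have h1 := hle (hPB x hx)
  rw [PointedCone.hull, Submodule.mem_span_range_iff_exists_fun] at h1
  obtain ⟨c, hc⟩ := h1
  refine ⟨fun i => c i, fun i => (c i).2, ?_⟩
  have : ∑ i, (c i : ℝ) • w i = x - v := hc
  rw [frameMap, this, add_sub_cancel]

end Edges

/-! ### Moments and cone integrals of simplices -/

section Simplices

open MeasureTheory

variable {d : ℕ} {σ : Finset (EuclideanSpace ℝ (Fin d))} {v : EuclideanSpace ℝ (Fin d)}
  {w : Fin d → EuclideanSpace ℝ (Fin d)}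

/-- The volume of the simplex with vertex set `σ`, relative to that of the corner simplex; this is
the absolute value of the determinant of the edge vectors at any vertex. -/
noncomputable def simplexWeight (σ : Finset (EuclideanSpace ℝ (Fin d))) : ℝ :=
  volume.real (convexHull ℝ (σ : Set (EuclideanSpace ℝ (Fin d)))) / volume.real (corner d)

open scoped Classical in
/-- `w` enumerates the edge vectors at `v` of the simplex with vertex set `σ`. -/
def IsSimplexFrame (σ : Finset (EuclideanSpace ℝ (Fin d))) (v : EuclideanSpace ℝ (Fin d))
    (w : Fin d → EuclideanSpace ℝ (Fin d)) : Prop :=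
  v ∈ σ ∧ Function.Injective w ∧ Finset.univ.image (fun i => v + w i) = σ.erase v

theorem IsFullSimplex.exists_frame (hσ : IsFullSimplex σ) (hv : v ∈ σ) :
    ∃ w : Fin d → EuclideanSpace ℝ (Fin d), IsSimplexFrame σ v w ∧ absDet w ≠ 0 := by
  classical
  have hcard : (σ.erase v).card = d := by
    rw [Finset.card_erase_of_mem hv, hσ.2, finrank_euclideanSpace_fin, Nat.add_sub_cancel]
  let e := (σ.erase v).equivFinOfCardEq hcard
  refine ⟨fun i => e.symm i - v, ⟨hv, fun i j h => ?_, ?_⟩, ?_⟩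
  · exact e.symm.injective (Subtype.ext (sub_left_injective h))
  · ext u
    simp only [add_sub_cancel, Finset.mem_image, Finset.mem_univ, true_and]
    exact ⟨fun ⟨i, hi⟩ => hi ▸ (e.symm i).2, fun hu => ⟨e ⟨u, hu⟩, by simp⟩⟩
  · apply absDet_ne_zero_of_linearIndependent
    have h1 := (affineIndependent_iff_linearIndependent_vsub ℝ _ (⟨v, hv⟩ : σ)).1 hσ.1
    let φ : Fin d → {x : σ // x ≠ ⟨v, hv⟩} := fun i =>
      ⟨⟨e.symm i, Finset.mem_of_mem_erase (e.symm i).2⟩, fun h =>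
        Finset.ne_of_mem_erase (e.symm i).2 (congrArg Subtype.val h)⟩
    have hφ : Function.Injective φ := fun i j h => by
      have : ((e.symm i : σ.erase v) : EuclideanSpace ℝ (Fin d)) = e.symm j :=
        congrArg (fun q => ((q : σ) : EuclideanSpace ℝ (Fin d))) (congrArg Subtype.val h)
      exact e.symm.injective (Subtype.ext this)
    exact h1.comp φ hφ

open scoped Classical in
theorem IsSimplexFrame.sum_erase (hw : IsSimplexFrame σ v w) {M : Type*} [AddCommMonoid M]
    (f : EuclideanSpace ℝ (Fin d) → M) : ∑ u ∈ σ.erase v, f u = ∑ i, f (v + w i) := by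
  rw [← hw.2.2, Finset.sum_image fun i _ j _ h => hw.2.1 (add_left_cancel h)]

open scoped Classical in
theorem IsSimplexFrame.prod_erase (hw : IsSimplexFrame σ v w)
    (f : EuclideanSpace ℝ (Fin d) → ℝ) : ∏ u ∈ σ.erase v, f u = ∏ i, f (v + w i) := by
  rw [← hw.2.2, Finset.prod_image fun i _ j _ h => hw.2.1 (add_left_cancel h)]

theorem IsSimplexFrame.add_mem (hw : IsSimplexFrame σ v w) (i : Fin d) : v + w i ∈ σ := by
  classical
  have : v + w i ∈ σ.erase v := hw.2.2 ▸ Finset.mem_image_of_mem _ (Finset.mem_univ i)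
  exact Finset.mem_of_mem_erase this

theorem IsSimplexFrame.convexHull_eq (hw : IsSimplexFrame σ v w) :
    convexHull ℝ (σ : Set (EuclideanSpace ℝ (Fin d))) = frameMap v w '' corner d := by
  classical
  apply Set.Subset.antisymm
  · intro x hx
    obtain ⟨c, hc0, hc1, rfl⟩ := Finset.mem_convexHull'.1 hx
    have h1 : c v + ∑ i, c (v + w i) = 1 := by
      rw [← hw.sum_erase c, Finset.add_sum_erase _ _ hw.1, hc1]
    refine ⟨fun i => c (v + w i), ⟨fun i => hc0 _ (hw.add_mem i), ?_⟩, ?_⟩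
    · linarith [hc0 v hw.1]
    · rw [← Finset.add_sum_erase _ _ hw.1, hw.sum_erase fun u => c u • u]
      simp only [smul_add, Finset.sum_add_distrib, ← Finset.sum_smul, frameMap]
      rw [← add_assoc, ← add_smul, h1, one_smul]
  · rintro _ ⟨t, ht, rfl⟩
    exact frameMap_mem_of_mem_corner (convex_convexHull ℝ _) (subset_convexHull ℝ _ hw.1)
      (fun i => subset_convexHull ℝ _ (hw.add_mem i)) ht

theorem IsSimplexFrame.simplexWeight_eq (hw : IsSimplexFrame σ v w) (hdet : absDet w ≠ 0) :
    simplexWeight σ = absDet w := by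
  rw [simplexWeight, hw.convexHull_eq, volume_real_frameMap_image v hdet (measurableSet_corner d),
    mul_div_cancel_right₀ _ (volume_real_corner_ne_zero d)]

theorem IsSimplexFrame.feasibleCone_eq (hw : IsSimplexFrame σ v w) :
    feasibleCone (convexHull ℝ (σ : Set (EuclideanSpace ℝ (Fin d)))) v =
      frameMap 0 w '' orthant d := by
  refine feasibleCone_eq_of_frame (convex_convexHull ℝ _) (subset_convexHull ℝ _ hw.1)
    (fun i => subset_convexHull ℝ _ (hw.add_mem i)) ?_
  rw [hw.convexHull_eq]
  exact Set.image_mono fun t ht => ht.1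

open scoped Classical in
/-- The contribution of the simplex `σ` to the coefficient of the vertex `v`. -/
noncomputable def simplexCoeff (σ : Finset (EuclideanSpace ℝ (Fin d)))
    (v z : EuclideanSpace ℝ (Fin d)) : ℝ :=
  simplexWeight σ * ∏ u ∈ σ.erase v, ⟪v - u, z⟫⁻¹

/-- The exponential integral over the cone of a simplex at a vertex `v` is the coefficient of `v`
in Brion's formula for this simplex. -/
theorem integrableOn_simplexCone_exp (hσ : IsFullSimplex σ) (hv : v ∈ σ)
    {z : EuclideanSpace ℝ (Fin d)} (hz : ∀ u ∈ σ, u ≠ v → 0 < ⟪v - u, z⟫) :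
    IntegrableOn (fun y => Real.exp ⟪y, z⟫)
      (feasibleCone (convexHull ℝ (σ : Set (EuclideanSpace ℝ (Fin d)))) v) ∧
    ∫ y in feasibleCone (convexHull ℝ (σ : Set (EuclideanSpace ℝ (Fin d)))) v,
      Real.exp ⟪y, z⟫ = simplexCoeff σ v z ∧
    MeasurableSet (feasibleCone (convexHull ℝ (σ : Set (EuclideanSpace ℝ (Fin d)))) v) := by
  classical
  obtain ⟨w, hw, hdet⟩ := hσ.exists_frame hv
  have hneg : ∀ i, ⟪w i, z⟫ < 0 := fun i => by
    have h1 : v + w i ∈ σ.erase v := hw.2.2 ▸ Finset.mem_image_of_mem _ (Finset.mem_univ i)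
    have h2 := hz _ (hw.add_mem i) (Finset.ne_of_mem_erase h1)
    rw [sub_add_cancel_left, inner_neg_left] at h2
    linarith
  rw [hw.feasibleCone_eq]
  refine ⟨integrableOn_cone_exp hdet hneg, ?_,
    measurableSet_frameMap_image 0 hdet (measurableSet_orthant d)⟩
  rw [integral_cone_exp hdet hneg, simplexCoeff, hw.simplexWeight_eq hdet,
    hw.prod_erase fun u => ⟪v - u, z⟫⁻¹]
  simp

theorem divDiff_eq_sum_finset {n : ℕ} {ι : Type*} [DecidableEq ι] {p : Fin n → ι}
    (hp : Function.Injective p) {σ : Finset ι} (hσ : Finset.univ.image p = σ) (f : ℝ → ℝ)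
    (x : ι → ℝ) : divDiff f (fun i => x (p i)) =
      ∑ v ∈ σ, f (x v) * ∏ u ∈ σ.erase v, (x v - x u)⁻¹ := by
  rw [divDiff, ← hσ, Finset.sum_image hp.injOn]
  refine Finset.sum_congr rfl fun i _ => ?_
  rw [← Finset.image_erase hp, Finset.prod_image hp.injOn,
    ← Finset.mul_prod_erase _ _ (Finset.mem_univ i), if_pos rfl, one_mul]
  congr 1
  exact Finset.prod_congr rfl fun j hj => if_neg (Finset.ne_of_mem_erase hj)

/-- **Brion's formula** for a simplex: the Hermite–Genocchi formula for divided powers, in terms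
of the vertex set of the simplex. -/
theorem integral_simplex_dividedPow (hσ : IsFullSimplex σ) {z : EuclideanSpace ℝ (Fin d)}
    (hz : Set.InjOn (fun u => ⟪u, z⟫) (σ : Set (EuclideanSpace ℝ (Fin d)))) (k : ℕ) :
    ∫ x in convexHull ℝ (σ : Set (EuclideanSpace ℝ (Fin d))), dividedPow d k 0 ⟪x, z⟫ =
      ∑ v ∈ σ, simplexCoeff σ v z * (⟪v, z⟫ ^ k / (k.factorial : ℝ)) := by
  classical
  have hne : σ.Nonempty := Finset.card_pos.1 (by rw [hσ.2]; omega)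
  obtain ⟨v, hv⟩ := hne
  obtain ⟨w, hw, hdet⟩ := hσ.exists_frame hv
  have hcont : Continuous (dividedPow d k 0) := by
    unfold dividedPow
    split_ifs <;> fun_prop
  have hvne : ∀ i, v + w i ≠ v := fun i => by
    have h1 : v + w i ∈ σ.erase v := hw.2.2 ▸ Finset.mem_image_of_mem _ (Finset.mem_univ i)
    exact Finset.ne_of_mem_erase h1
  let p : Fin (d + 1) → EuclideanSpace ℝ (Fin d) := Fin.cons v fun i => v + w i
  have hp : Function.Injective p :=
    Fin.cons_injective_iff.2 ⟨fun ⟨i, hi⟩ => hvne i hi, fun i j h => hw.2.1 (add_left_cancel h)⟩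
  have hpσ : Finset.univ.image p = σ := by
    rw [← Finset.insert_erase hv, ← hw.2.2]
    ext u
    simp [p, Fin.exists_fin_succ, eq_comm]
  rw [hw.convexHull_eq, integral_frameMap_image v hdet (measurableSet_corner d)]
  have hg := hermite_genocchi (dividedPow d k) (hasDerivAt_dividedPow d k) hcont ⟪v, z⟫
    (fun i => ⟪v + w i, z⟫) (fun i h => hvne i (hz (hw.add_mem i) hv h))
    (fun i j h => hw.2.1 (add_left_cancel (hz (hw.add_mem i) (hw.add_mem j) h)))
  have e1 : ∀ t : Fin d → ℝ, ⟪frameMap v w t, z⟫ =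
      ⟪v, z⟫ + ∑ i, t i * (⟪v + w i, z⟫ - ⟪v, z⟫) := fun t => by
    simp [inner_frameMap, inner_add_left]
  have e2 : (Fin.cons ⟪v, z⟫ fun i => ⟪v + w i, z⟫ : Fin (d + 1) → ℝ) = fun i => ⟪p i, z⟫ := by
    ext i
    refine Fin.cases ?_ (fun i => ?_) i <;> simp [p]
  simp_rw [e1]
  rw [hg, e2, divDiff_eq_sum_finset hp hpσ _ fun u => ⟪u, z⟫, Finset.mul_sum]
  refine Finset.sum_congr rfl fun u _ => ?_
  rw [simplexCoeff, hw.simplexWeight_eq hdet, dividedPow, if_neg (by omega),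
    Nat.add_sub_cancel_left]
  simp_rw [inner_sub_left]
  ring

theorem setIntegral_eq_sum_of_ae_indicator {α ι : Type*} [MeasurableSpace α] {ν : Measure α}
    {T : Finset ι} {A : Set α} (hA : MeasurableSet A) {S : ι → Set α}
    (hS : ∀ i ∈ T, MeasurableSet (S i)) {f : α → ℝ} (hf : ∀ i ∈ T, IntegrableOn f (S i) ν)
    (h : ∀ᵐ x ∂ν, A.indicator (1 : α → ℝ) x = ∑ i ∈ T, (S i).indicator (1 : α → ℝ) x) :
    ∫ x in A, f x ∂ν = ∑ i ∈ T, ∫ x in S i, f x ∂ν := by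
  have e : ∀ (B : Set α) x, B.indicator f x = B.indicator (1 : α → ℝ) x * f x := fun B x => by
    by_cases hx : x ∈ B <;> simp [hx]
  calc ∫ x in A, f x ∂ν = ∫ x, A.indicator f x ∂ν := (integral_indicator hA).symm
    _ = ∫ x, ∑ i ∈ T, (S i).indicator f x ∂ν := by
        refine integral_congr_ae ?_
        filter_upwards [h] with x hx
        rw [e, hx, Finset.sum_mul]
        exact Finset.sum_congr rfl fun i _ => (e _ _).symm
    _ = ∑ i ∈ T, ∫ x, (S i).indicator f x ∂ν :=
        integral_finsetSum _ fun i hi => (integrable_indicator_iff (hS i hi)).2 (hf i hi)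
    _ = ∑ i ∈ T, ∫ x in S i, f x ∂ν :=
        Finset.sum_congr rfl fun i hi => integral_indicator (hS i hi)

end Simplices

/-! ### Comparison of the simplices at a vertex with the edge cone -/

section Vertex

open MeasureTheory

variable {d : ℕ} {P : Set (EuclideanSpace ℝ (Fin d))} {s : Finset (EuclideanSpace ℝ (Fin d))}
  {T : Finset (Finset (EuclideanSpace ℝ (Fin d)))} {v : EuclideanSpace ℝ (Fin d)}
  {w : Fin d → EuclideanSpace ℝ (Fin d)}

theorem ae_comp_add_smul {p : EuclideanSpace ℝ (Fin d) → Prop} (hp : ∀ᵐ x, p x)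
    (v : EuclideanSpace ℝ (Fin d)) {c : ℝ} (hc : c ≠ 0) : ∀ᵐ y, p (v + c • y) := by
  rw [ae_iff] at hp ⊢
  have h1 : {y | ¬ p (v + c • y)} = (c • ·) ⁻¹' ((v + ·) ⁻¹' {x | ¬ p x}) := rfl
  rw [h1, Measure.addHaar_preimage_smul _ hc, measure_preimage_add, hp, mul_zero]

theorem mem_of_mem_convexHull_of_extreme
    (hP : P = convexHull ℝ (s : Set (EuclideanSpace ℝ (Fin d)))) (hv : v ∈ P.extremePoints ℝ)
    {σ : Finset (EuclideanSpace ℝ (Fin d))} (hσ : σ ⊆ s)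
    (h : v ∈ convexHull ℝ (σ : Set (EuclideanSpace ℝ (Fin d)))) : v ∈ σ := by
  have hsub : convexHull ℝ (σ : Set (EuclideanSpace ℝ (Fin d))) ⊆ P :=
    hP ▸ convexHull_mono (Finset.coe_subset.2 hσ)
  exact extremePoints_convexHull_subset
    (inter_extremePoints_subset_extremePoints_of_subset hsub ⟨h, hv⟩)

open scoped Classical in
/-- A decomposition of a polytope into simplices induces, by blowing up at a vertex, a
decomposition of the cone of feasible directions at this vertex. -/
theorem ae_indicator_feasibleCone (hP : P = convexHull ℝ (s : Set (EuclideanSpace ℝ (Fin d))))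
    (hv : v ∈ P.extremePoints ℝ) (hTs : ∀ σ ∈ T, σ ⊆ s)
    (hT : ∀ᵐ x, P.indicator (1 : EuclideanSpace ℝ (Fin d) → ℝ) x =
      ∑ σ ∈ T, (convexHull ℝ (σ : Set (EuclideanSpace ℝ (Fin d)))).indicator
        (1 : EuclideanSpace ℝ (Fin d) → ℝ) x) :
    ∀ᵐ y, (feasibleCone P v).indicator (1 : EuclideanSpace ℝ (Fin d) → ℝ) y =
      ∑ σ ∈ T with v ∈ σ, (feasibleCone (convexHull ℝ (σ : Set (EuclideanSpace ℝ (Fin d))))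
        v).indicator (1 : EuclideanSpace ℝ (Fin d) → ℝ) y := by
  have h1 : ∀ᵐ y : EuclideanSpace ℝ (Fin d), ∀ n : ℕ, P.indicator
      (1 : EuclideanSpace ℝ (Fin d) → ℝ) (v + (1 / ((n : ℝ) + 1)) • y) =
      ∑ σ ∈ T, (convexHull ℝ (σ : Set (EuclideanSpace ℝ (Fin d)))).indicator
        (1 : EuclideanSpace ℝ (Fin d) → ℝ) (v + (1 / ((n : ℝ) + 1)) • y) :=
    ae_all_iff.2 fun n => ae_comp_add_smul hT v (by positivity)
  filter_upwards [h1] with y hy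
  have hcP : Convex ℝ P := hP ▸ convex_convexHull ℝ _
  have h2 := eventually_mem_iff_mem_feasibleCone hcP hv.1 y
  have h3 : ∀ᶠ n : ℕ in Filter.atTop, ∀ σ ∈ T,
      (convexHull ℝ (σ : Set (EuclideanSpace ℝ (Fin d)))).indicator
        (1 : EuclideanSpace ℝ (Fin d) → ℝ) (v + (1 / ((n : ℝ) + 1)) • y) =
      if v ∈ σ then (feasibleCone (convexHull ℝ (σ : Set (EuclideanSpace ℝ (Fin d))))
        v).indicator (1 : EuclideanSpace ℝ (Fin d) → ℝ) y else 0 := by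
    rw [Filter.eventually_all_finset]
    intro σ hσ
    by_cases hvσ : v ∈ σ
    · filter_upwards [eventually_mem_iff_mem_feasibleCone (convex_convexHull ℝ _)
        (subset_convexHull ℝ _ (Finset.mem_coe.2 hvσ)) y] with n hn
      simp only [hvσ, if_true, Set.indicator_apply, hn, Pi.one_apply]
    · have hcl : IsClosed (convexHull ℝ (σ : Set (EuclideanSpace ℝ (Fin d)))) :=
        (σ.finite_toSet.isCompact_convexHull (𝕜 := ℝ)).isClosed
      filter_upwards [eventually_notMem_of_notMem hcl
        (fun h => hvσ (mem_of_mem_convexHull_of_extreme hP hv (hTs σ hσ) h)) y] with n hn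
      simp only [hvσ, if_false, Set.indicator_of_notMem hn]
  -- Close to `v`, the polytope and the simplices agree with their cones, and the simplices that
  -- do not contain `v` are out of reach.
  obtain ⟨n, hn2, hn3⟩ := (h2.and h3).exists
  have h4 := hy n
  rw [Finset.sum_congr rfl hn3, ← Finset.sum_filter] at h4
  rw [← h4]
  simp only [Set.indicator_apply, hn2, Pi.one_apply]

/-- Linearly independent vectors lie in a common open half-space. -/
theorem exists_inner_eq_neg_one (hw : absDet w ≠ 0) :
    ∃ z : EuclideanSpace ℝ (Fin d), ∀ i, ⟪w i, z⟫ = -1 := by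
  have hM := abs_ne_zero.1 hw
  let M : Matrix (Fin d) (Fin d) ℝ := Matrix.of fun i k => w k i
  have hu : IsUnit M.transpose.det := by rw [Matrix.det_transpose]; exact hM.isUnit
  refine ⟨WithLp.toLp 2 (M.transpose⁻¹.mulVec fun _ => -1), fun i => ?_⟩
  have h : M.transpose.mulVec (M.transpose⁻¹.mulVec fun _ => -1) = fun _ => -1 := by
    rw [Matrix.mulVec_mulVec, Matrix.mul_nonsing_inv _ hu, Matrix.one_mulVec]
  refine Eq.trans ?_ (congrFun h i)
  simp [PiLp.inner_apply, Matrix.mulVec, dotProduct, M, mul_comm]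

theorem prod_inv_mul_prod {ι : Type*} [DecidableEq ι] {A B : Finset ι} (hBA : B ⊆ A) {f : ι → ℝ}
    (hf : ∀ u ∈ A, f u ≠ 0) : (∏ u ∈ B, (f u)⁻¹) * ∏ u ∈ A, f u = ∏ u ∈ A \ B, f u := by
  rw [← Finset.prod_sdiff hBA, Finset.prod_inv_distrib, mul_comm, mul_assoc,
    mul_inv_cancel₀ (Finset.prod_ne_zero_iff.2 fun u hu => hf u (hBA hu)), mul_one]

open scoped Classical in
/-- For directions in the interior of the polar cone of the edge cone at `v`, the simplices at `v`
contribute together as much as the edge cone. -/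
theorem sum_simplexCoeff_of_neg (hP : P = convexHull ℝ (s : Set (EuclideanSpace ℝ (Fin d))))
    (hv : v ∈ P.extremePoints ℝ) (hTs : ∀ σ ∈ T, σ ⊆ s ∧ IsFullSimplex σ)
    (hT : ∀ᵐ x, P.indicator (1 : EuclideanSpace ℝ (Fin d) → ℝ) x =
      ∑ σ ∈ T, (convexHull ℝ (σ : Set (EuclideanSpace ℝ (Fin d)))).indicator
        (1 : EuclideanSpace ℝ (Fin d) → ℝ) x)
    (hwP : ∀ i, v + w i ∈ P) (hsub : P ⊆ frameMap v w '' orthant d) (hdet : absDet w ≠ 0)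
    {z : EuclideanSpace ℝ (Fin d)} (hz : ∀ i, ⟪w i, z⟫ < 0)
    (hz' : ∀ u ∈ s, u ≠ v → 0 < ⟪v - u, z⟫) :
    ∑ σ ∈ T with v ∈ σ, simplexCoeff σ v z = absDet w * ∏ i, (-⟪w i, z⟫)⁻¹ := by
  have hcP : Convex ℝ P := hP ▸ convex_convexHull ℝ _
  have hσ : ∀ σ ∈ T.filter (v ∈ ·), _ := fun σ hσ =>
    integrableOn_simplexCone_exp (hTs σ (Finset.mem_filter.1 hσ).1).2 (Finset.mem_filter.1 hσ).2
      fun u hu huv => hz' u ((hTs σ (Finset.mem_filter.1 hσ).1).1 hu) huv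
  have hcone := feasibleCone_eq_of_frame hcP hv.1 hwP hsub
  have h := setIntegral_eq_sum_of_ae_indicator (A := feasibleCone P v)
    (by rw [hcone]; exact measurableSet_frameMap_image 0 hdet (measurableSet_orthant d))
    (fun σ h => (hσ σ h).2.2) (fun σ h => (hσ σ h).1)
    (ae_indicator_feasibleCone hP hv (fun σ h => (hTs σ h).1) hT)
  rw [hcone, integral_cone_exp hdet hz] at h
  rw [h]
  exact Finset.sum_congr rfl fun σ h => (hσ σ h).2.1.symm

theorem analyticOnNhd_prod_inner (A : Finset (EuclideanSpace ℝ (Fin d)))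
    (v : EuclideanSpace ℝ (Fin d)) :
    AnalyticOnNhd ℝ (fun z => ∏ u ∈ A, ⟪v - u, z⟫) Set.univ := fun z _ => by
  refine Finset.analyticAt_fun_prod _ fun u _ => ?_
  exact (innerSL ℝ (v - u)).analyticAt z

open scoped Classical in
/-- The identity between the coefficients of the simplices at a vertex and of the edge cone,
cleared of denominators. It holds in all directions, since both sides are polynomial in `z`. -/
theorem sum_simplexWeight_mul_prod
    (hP : P = convexHull ℝ (s : Set (EuclideanSpace ℝ (Fin d))))
    (hv : v ∈ P.extremePoints ℝ) (hTs : ∀ σ ∈ T, σ ⊆ s ∧ IsFullSimplex σ)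
    (hT : ∀ᵐ x, P.indicator (1 : EuclideanSpace ℝ (Fin d) → ℝ) x =
      ∑ σ ∈ T, (convexHull ℝ (σ : Set (EuclideanSpace ℝ (Fin d)))).indicator
        (1 : EuclideanSpace ℝ (Fin d) → ℝ) x)
    (hws : ∀ i, v + w i ∈ s.erase v) (hinj : Function.Injective w)
    (hsub : P ⊆ frameMap v w '' orthant d) (hdet : absDet w ≠ 0)
    (z : EuclideanSpace ℝ (Fin d)) :
    ∑ σ ∈ T with v ∈ σ, simplexWeight σ * ∏ u ∈ s.erase v \ σ.erase v, ⟪v - u, z⟫ =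
      absDet w * ∏ u ∈ s.erase v \ Finset.univ.image (fun i => v + w i), ⟪v - u, z⟫ := by
  have hsP : ∀ u ∈ s, u ∈ P := fun u hu => hP ▸ subset_convexHull ℝ _ hu
  obtain ⟨z₀, hz₀⟩ := exists_inner_eq_neg_one hdet
  have hopen : IsOpen {z : EuclideanSpace ℝ (Fin d) | ∀ i, ⟪w i, z⟫ < 0} := by
    have : {z : EuclideanSpace ℝ (Fin d) | ∀ i, ⟪w i, z⟫ < 0} =
        ⋂ i, {z : EuclideanSpace ℝ (Fin d) | ⟪w i, z⟫ < 0} := by ext; simp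
    rw [this]
    exact isOpen_iInter_of_finite fun i => isOpen_lt (by fun_prop) continuous_const
  refine congrFun (AnalyticOnNhd.eq_of_eventuallyEq (𝕜 := ℝ) (z₀ := z₀)
    (f := fun z => ∑ σ ∈ T with v ∈ σ,
      simplexWeight σ * ∏ u ∈ s.erase v \ σ.erase v, ⟪v - u, z⟫)
    (g := fun z => absDet w *
      ∏ u ∈ s.erase v \ Finset.univ.image (fun i => v + w i), ⟪v - u, z⟫) ?_ ?_ ?_) z
  · intro x hx
    exact Finset.analyticAt_fun_sum _ fun σ _ =>
      analyticAt_const.mul (analyticOnNhd_prod_inner _ v x hx)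
  · intro x hx
    exact analyticAt_const.mul (analyticOnNhd_prod_inner _ v x hx)
  -- The identity holds on the interior of the polar cone, by comparison of exponential integrals.
  filter_upwards [hopen.mem_nhds (fun i => by rw [hz₀ i]; norm_num)] with z hz
  have hz' : ∀ u ∈ s, u ≠ v → 0 < ⟪v - u, z⟫ := by
    intro u hu huv
    obtain ⟨t, ht, rfl⟩ := hsub (hsP u hu)
    have hex : ∃ i, t i ≠ 0 := by
      by_contra hno
      push Not at hno
      exact huv (by simp [frameMap, hno])
    obtain ⟨i, hi⟩ := hex
    rw [inner_sub_left, inner_frameMap, sub_add_cancel_left, ← Finset.sum_neg_distrib]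
    refine Finset.sum_pos' (fun j _ => ?_) ⟨i, Finset.mem_univ i, ?_⟩
    · exact neg_nonneg.2 (mul_nonpos_of_nonneg_of_nonpos (ht j) (hz j).le)
    · exact neg_pos.2 (mul_neg_of_pos_of_neg (lt_of_le_of_ne (ht i) hi.symm) (hz i))
  have hne : ∀ u ∈ s.erase v, ⟪v - u, z⟫ ≠ 0 := fun u hu =>
    (hz' u (Finset.mem_of_mem_erase hu) (Finset.ne_of_mem_erase hu)).ne'
  have h := sum_simplexCoeff_of_neg hP hv hTs hT
    (fun i => hsP _ (Finset.mem_of_mem_erase (hws i))) hsub hdet hz hz'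
  have h2 := congrArg (· * ∏ u ∈ s.erase v, ⟪v - u, z⟫) h
  simp only [Finset.sum_mul, simplexCoeff, mul_assoc] at h2
  have e1 : ∀ σ ∈ T.filter (v ∈ ·), simplexWeight σ * ((∏ u ∈ σ.erase v, ⟪v - u, z⟫⁻¹) *
      ∏ u ∈ s.erase v, ⟪v - u, z⟫) =
      simplexWeight σ * ∏ u ∈ s.erase v \ σ.erase v, ⟪v - u, z⟫ := fun σ hσ => by
    rw [prod_inv_mul_prod (Finset.erase_subset_erase _ (hTs σ (Finset.mem_filter.1 hσ).1).1) hne]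
  have e2 : ∏ i, (-⟪w i, z⟫)⁻¹ = ∏ u ∈ Finset.univ.image (fun i => v + w i), ⟪v - u, z⟫⁻¹ := by
    rw [Finset.prod_image fun i _ j _ h => hinj (add_left_cancel h)]
    simp
  rw [Finset.sum_congr rfl e1, e2, prod_inv_mul_prod (Finset.image_subset_iff.2 fun i _ => hws i)
    hne] at h2
  exact h2

end Vertex

/-! ### Brion's formula for moments of simple polytopes -/

section Brion

open MeasureTheory

variable {d : ℕ} {P : Set (EuclideanSpace ℝ (Fin d))}

theorem IsSimplePolytope.finite_vert (hP : IsSimplePolytope P) : (vert P).Finite := by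
  obtain ⟨s, rfl⟩ := hP.exists_finset
  exact s.finite_toSet.subset extremePoints_convexHull_subset

theorem IsSimplePolytope.eq_convexHull_vert (hP : IsSimplePolytope P) :
    P = convexHull ℝ (vert P) := by
  have hfin := hP.finite_vert
  obtain ⟨s, hs⟩ := hP.exists_finset
  have h := closure_convexHull_extremePoints (E := EuclideanSpace ℝ (Fin d)) (s := P)
    (hs ▸ s.finite_toSet.isCompact_convexHull (𝕜 := ℝ)) (hs ▸ convex_convexHull ℝ _)
  change closure (convexHull ℝ (vert P)) = P at h
  rw [(hfin.isCompact_convexHull (𝕜 := ℝ)).isClosed.closure_eq] at h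
  exact h.symm

theorem IsSimplePolytope.exists_edgeFrame (hP : IsSimplePolytope P)
    {v : EuclideanSpace ℝ (Fin d)} (hv : v ∈ vert P) :
    ∃ w : Fin d → EuclideanSpace ℝ (Fin d), IsEdgeFrame P v w := by
  have hfin : (neighbors P v).Finite := hP.finite_vert.subset fun u hu => hu.1
  have hcard : hfin.toFinset.card = d := by
    rw [← Set.ncard_eq_toFinset_card _ hfin, hP.simple v hv]
  let e := hfin.toFinset.equivFinOfCardEq hcard
  refine ⟨fun i => e.symm i - v, fun i j h => ?_, ?_⟩
  · exact e.symm.injective (Subtype.ext (sub_left_injective h))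
  · ext x
    constructor
    · rintro ⟨i, rfl⟩
      exact ⟨e.symm i, hfin.mem_toFinset.1 (e.symm i).2, rfl⟩
    · rintro ⟨u, hu, rfl⟩
      exact ⟨e ⟨u, hfin.mem_toFinset.2 hu⟩, by simp⟩

theorem scaledMoment_succ (P : Set (EuclideanSpace ℝ (Fin d))) (z : EuclideanSpace ℝ (Fin d))
    (k : ℕ) : scaledMoment P z (k + 1) =
      (-1) ^ d * (k.factorial : ℝ) * ∫ x in P, dividedPow d k 0 ⟪x, z⟫ := by
  unfold scaledMoment dividedPow moment
  by_cases h : k < d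
  · simp [h, Nat.succ_le_of_lt h]
  · rw [if_neg (by omega)]
    simp only [zero_add, h, if_false, Nat.add_sub_cancel]
    rw [integral_div]
    ring

/-- A form of **Brion's formula** for the moments of a simple polytope: the scaled moments are
power sums of the projections of the vertices, with nonzero weights. The weight of a vertex is the
sum of the contributions of the simplices of a triangulation at this vertex; it is nonzero because,
cleared of denominators, it equals the determinant of the edge vectors times a product of factors
`⟪v - u, z⟫`. -/
theorem exists_scaledMoment_eq_sum (hP : IsSimplePolytope P) {z : EuclideanSpace ℝ (Fin d)}
    (hz : GeneralPosition P z) :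
    ∃ B : EuclideanSpace ℝ (Fin d) → ℝ, (∀ v ∈ hP.finite_vert.toFinset, B v ≠ 0) ∧
      ∀ k, scaledMoment P z (k + 1) =
        ∑ v ∈ hP.finite_vert.toFinset, B v * ⟪v, z⟫ ^ k := by
  classical
  set s := hP.finite_vert.toFinset with hs
  have hPs : P = convexHull ℝ (s : Set (EuclideanSpace ℝ (Fin d))) := by
    rw [hs, Set.Finite.coe_toFinset]
    exact hP.eq_convexHull_vert
  have hmem : ∀ u, u ∈ s ↔ u ∈ vert P := fun u => Set.Finite.mem_toFinset _
  obtain ⟨T, hTs, hT⟩ := exists_triangulation (volume : Measure (EuclideanSpace ℝ (Fin d))) s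
  rw [← hPs] at hT
  have hinj : ∀ u ∈ s, ∀ v ∈ s, ⟪u, z⟫ = ⟪v, z⟫ → u = v := fun u hu v hv h =>
    hz.injOn ((hmem u).1 hu) ((hmem v).1 hv) h
  refine ⟨fun v => (-1) ^ d * ∑ σ ∈ T with v ∈ σ, simplexCoeff σ v z, fun v hv => ?_, fun k => ?_⟩
  · obtain ⟨w, hw⟩ := hP.exists_edgeFrame ((hmem v).1 hv)
    have hdet : absDet w ≠ 0 := fun h0 => by
      refine hz.not_zero v ((hmem v).1 hv) w hw ?_
      rw [vertexCoeff, show |(Matrix.of fun i k => w k i).det| = 0 from h0, zero_div]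
    have hws : ∀ i, v + w i ∈ s.erase v := fun i => by
      have : w i ∈ (fun u => u - v) '' neighbors P v := hw.2 ▸ Set.mem_range_self i
      obtain ⟨u, hu, hui⟩ := this
      have hu' : v + w i = u := by rw [← hui]; exact add_sub_cancel v u
      rw [hu', Finset.mem_erase, hmem]
      exact ⟨hu.2.1, hu.1⟩
    have hvP : v ∈ P.extremePoints ℝ := (hmem v).1 hv
    have h := sum_simplexWeight_mul_prod hPs hvP hTs hT hws hw.1
      (subset_cone_of_edges hPs hvP hw.2) hdet z
    have hne : ∀ u ∈ s.erase v, ⟪v - u, z⟫ ≠ 0 := fun u hu h0 => by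
      rw [inner_sub_left, sub_eq_zero] at h0
      exact Finset.ne_of_mem_erase hu (hinj v hv u (Finset.mem_of_mem_erase hu) h0).symm
    have h1 : ∑ σ ∈ T with v ∈ σ, simplexWeight σ *
        ∏ u ∈ s.erase v \ σ.erase v, ⟪v - u, z⟫ =
        (∑ σ ∈ T with v ∈ σ, simplexCoeff σ v z) * ∏ u ∈ s.erase v, ⟪v - u, z⟫ := by
      rw [Finset.sum_mul]
      refine Finset.sum_congr rfl fun σ hσ => ?_
      rw [simplexCoeff, mul_assoc, prod_inv_mul_prod
        (Finset.erase_subset_erase _ (hTs σ (Finset.mem_filter.1 hσ).1).1) hne]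
    have h2 : absDet w * ∏ u ∈ s.erase v \ Finset.univ.image (fun i => v + w i),
        ⟪v - u, z⟫ ≠ 0 :=
      mul_ne_zero hdet (Finset.prod_ne_zero_iff.2 fun u hu => hne u (Finset.mem_sdiff.1 hu).1)
    rw [← h, h1] at h2
    exact mul_ne_zero (pow_ne_zero _ (by norm_num)) (left_ne_zero_of_mul h2)
  · have hcont : Continuous fun x : EuclideanSpace ℝ (Fin d) => dividedPow d k 0 ⟪x, z⟫ := by
      unfold dividedPow
      split_ifs <;> fun_prop
    have hcpt : ∀ σ : Finset (EuclideanSpace ℝ (Fin d)),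
        IsCompact (convexHull ℝ (σ : Set (EuclideanSpace ℝ (Fin d)))) := fun σ =>
      σ.finite_toSet.isCompact_convexHull (𝕜 := ℝ)
    rw [scaledMoment_succ, setIntegral_eq_sum_of_ae_indicator
      (by rw [hPs]; exact (hcpt s).isClosed.measurableSet)
      (fun σ _ => (hcpt σ).isClosed.measurableSet)
      (fun σ _ => hcont.continuousOn.integrableOn_compact (hcpt σ)) hT]
    have h1 : ∀ σ ∈ T, ∫ x in convexHull ℝ (σ : Set (EuclideanSpace ℝ (Fin d))),
        dividedPow d k 0 ⟪x, z⟫ =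
        ∑ v ∈ s, if v ∈ σ then simplexCoeff σ v z * (⟪v, z⟫ ^ k / (k.factorial : ℝ)) else 0 := by
      intro σ hσ
      have hσs := (hTs σ hσ).1
      rw [integral_simplex_dividedPow (hTs σ hσ).2
        (fun u hu v hv h => hinj u (hσs hu) v (hσs hv) h), ← Finset.sum_filter,
        Finset.filter_mem_eq_inter, Finset.inter_eq_right.2 hσs]
    rw [Finset.sum_congr rfl h1, Finset.sum_comm, Finset.mul_sum]
    refine Finset.sum_congr rfl fun v _ => ?_
    rw [← Finset.sum_filter, ← Finset.sum_mul]
    have : (k.factorial : ℝ) ≠ 0 := by positivity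
    field_simp

end Brion

end InverseMoment

/-! ### The kernel of the Hankel matrix of scaled moments -/

theorem mainTheorem2 (d : ℕ) (P : Set (EuclideanSpace ℝ (Fin d)))
    (hP : InverseMoment.IsSimplePolytope P)
    (N : ℕ) (hN : (InverseMoment.vert P).ncard = N)
    (z : EuclideanSpace ℝ (Fin d)) (hz : InverseMoment.GeneralPosition P z)
    (m : ℕ) (hm : N + 1 ≤ m) :
    (InverseMoment.hankel (InverseMoment.scaledMoment P z) m).rank = N ∧
    LinearIndependent ℝ
      (fun l : Fin (m - N) => InverseMoment.shiftedCoeffs (InverseMoment.projPoly P z) m l) ∧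
    LinearMap.ker (InverseMoment.hankel (InverseMoment.scaledMoment P z) m).mulVecLin =
      Submodule.span ℝ (Set.range
        (fun l : Fin (m - N) =>
          InverseMoment.shiftedCoeffs (InverseMoment.projPoly P z) m l)) := by
  have hfin := hP.finite_vert
  obtain ⟨B, hB, hc⟩ := InverseMoment.exists_scaledMoment_eq_sum hP hz
  have hcard : hfin.toFinset.card = N := by rw [← Set.ncard_eq_toFinset_card _ hfin, hN]
  subst hcard
  refine InverseMoment.hankel_rank_and_ker (x := fun v => ⟪v, z⟫) ?_ hB hc (by omega) ?_
  · rw [Set.Finite.coe_toFinset]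
    exact hz.injOn
  · exact finprod_mem_eq_finite_toFinset_prod _ hfin
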